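/- **Setting.** Let $d\ge 1$. Fix a smooth orthonormal dyadic wavelet basis $(\psi_\lambda)_{\lambda\in\Lambda}$ of $L_2(\mathbb R^d)$ (for example the Meyer basis): it consists of the integer translates of a Schwartz function (level $|\lambda|=0$) and of $2^{jd/2}\psi_e(2^jx-k)$, $j\ge 0$, $k\in\mathbb Z^d$, $1\le e\le 2^d-1$ (level $|\lambda|=j$), where the $\psi_e$ are Schwartz functions all of whose polynomial moments vanish. All functions and distributions are real-valued. For a tempered distribution $u$ put $u_\lambda=\langle u,\psi_\lambda\rangle$ and, for $s\in\mathbb R$, $p>0$, $$\|u\|_{B^s_p}=\Big(\sum_{\lambda\in\Lambda}2^{p(s+d(\frac12-\frac1p))|\lambda|}\,|u_\lambda|^p\Big)^{1/p}\in[0,\infty],\qquad B^s_p=\{u:\|u\|_{B^s_p}<\infty\},\qquad H^s=B^s_2 .$$ Write $p^*=p/(p-1)$ (with $p_G/p_G^*=p_G-1$ in general, in particular $=0$ for $p_G=1$). Let $\mathcal B_D=B^{s_D}_{p_D}$ with $p_D>1$, and $\mathcal B_S=B^{s_S}_{p_S}$, $\mathcal B_G=B^{s_G}_{p_G}$ with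 $p_S,p_G>0$. Assume $\mathcal B_S\subset\mathcal B_D$ in the sense $$p_S\le p_D,\qquad s_S-\tfrac d{p_S}>s_D-\tfrac d{p_D},$$ assume $\mathcal B_G\subset\mathcal B_D^*=B^{-s_D}_{p_D^*}$ in the sense $$\tfrac1{p_G}\ge\tfrac1{p_D^*},\qquad s_G-\tfrac d{p_G}\ge -s_D-\tfrac d{p_D^*},$$ and assume $p_S\le p_G$. Let $F:\mathcal B_D\to L_2(\mathbb R^d)$ be linear and continuous with $\mathcal B_G\subset\operatorname{rg}F^*$ (in particular, $\operatorname{rg}F^*=\mathcal B_G$ is allowed). Here $g\in\operatorname{rg}F^*$ means that for some $w\in L_2$ one has $\langle w,Fu\rangle=\sum_\lambda g_\lambda u_\lambda$ for all $u\in\mathcal B_D$. For $\varepsilon>0$ the *allowed penalties* are the functionals $\|\cdot\|_{B^{s_R}_{p_R}}^{p_R}$ such that for some $p>0$ with $p_S\le p\le\min\{p_D,p_G\}$ $$p_R=\frac{p+p_G}{p_G},\qquad s_R\le\frac{p\,s_S-p_Gs_G}{p+p_G}-d\,\frac1{p+p_G}\Big(\frac p{p_S}-1\Big)-\varepsilon\Big(\frac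 p{p_S}-1\Big),\tag{1}$$ and the exponent of such a penalty is $\sigma=s_R+d\big(\tfrac12-\tfrac1{p_R}\big)$. For $y\in L_2$ and $\alpha>0$ let $T_\alpha(u)=\|Fu-y\|_{L_2}^2+\alpha\|u\|_{B^{s_R}_{p_R}}^{p_R}$ for $u\in\mathcal B_D$, with values in $[0,\infty]$. For $u^\dagger\in\mathcal B_D$ we say that the penalty gives *the rate in $H^\tau$* if for all $a,b>0$ there are $K,\delta_0>0$ such that for all $0<\delta<\delta_0$, all $\alpha\in[a\delta,b\delta]$, all $y=v^\delta\in L_2$ with $\|Fu^\dagger-v^\delta\|_{L_2}\le\delta$ and every minimizer $u^{\alpha,\delta}$ of $T_\alpha$ over $\mathcal B_D$ $$\|u^{\alpha,\delta}-u^\dagger\|_{H^\tau}\le K\sqrt\delta .$$ **Statement.** Let $p=\min\{p_D,p_G\}$, and let the *optimal penalty* be the one with this $p$ and with equality in (1); write $\sigma_\varepsilon(\mathcal B_S)$ for its exponent $\sigma$, and also use this formula for $\varepsilon=0$. 1. There is $\varepsilon_0>0$, depending only on $d$ and the indices of $\mathcal B_D,\mathcal B_S,\mathcal B_G$, such that for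 all $0<\varepsilon<\varepsilon_0$ the optimal penalty is allowed and is the unique allowed penalty with the largest $\sigma$. Moreover, $\|u\|_{H^\sigma}\le\|u\|_{H^{\sigma_\varepsilon(\mathcal B_S)}}$ for every tempered distribution $u$ and the exponent $\sigma$ of every allowed penalty, so that the optimal penalty gives the strongest rate. 2. Let $p_G\ge p_D$, $\varepsilon>0$ and $\tilde\varepsilon=\varepsilon\big(\frac{p_D}{p_S}-1\big)$. Then the optimal penalty has $$p_R=\frac{p_D+p_G}{p_G},\qquad s_R=\frac{p_Ds_S-p_Gs_G}{p_D+p_G}-d\,\frac1{p_D+p_G}\Big(\frac{p_D}{p_S}-1\Big)-\tilde\varepsilon,$$ and for every $u^\dagger\in\mathcal B_S$ it gives the rate in $H^\sigma$ with $$\sigma=\frac{p_Ds_S-p_Gs_G}{p_D+p_G}+d\Big[\frac12-\frac1{p_D+p_G}\Big(\frac{p_G}{p_G^*}+\frac{p_D}{p_S}\Big)\Big]-\tilde\varepsilon=\sigma_\varepsilon(\mathcal B_S).$$ 3. Let $p_G<p_D$, $\varepsilon>0$ and $\tilde\varepsilon=\varepsilon\big(\frac{p_G}{p_S}-1\big)$.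 Then the optimal penalty has $$p_R=2,\qquad s_R=\tfrac12\Big(s_S-\frac d{p_S}-\Big(s_G-\frac d{p_G}\Big)\Big)-\tilde\varepsilon=\sigma_\varepsilon(\mathcal B_S),$$ and for every $u^\dagger\in\mathcal B_S$ it gives the rate in $B^{s_R}_{p_R}=H^{s_R}$. 4. Let $\mathcal B_T=B^{s_T}_{p_T}\subset\mathcal B_S$ be a tighter source condition, that is, $0<p_T\le p_S$ and $s_T-\frac d{p_T}>s_S-\frac d{p_S}$. Then, neglecting $\varepsilon$, $$\sigma_0(\mathcal B_T)-\sigma_0(\mathcal B_S)=c\,\Big(s_T-\frac d{p_T}-\Big(s_S-\frac d{p_S}\Big)\Big)>0,\qquad c=\frac{p_D}{p_D+p_G}\ \text{ if }p_G\ge p_D,\quad c=\tfrac12\ \text{ if }p_G<p_D,$$ and $\sigma_\varepsilon(\mathcal B_T)>\sigma_\varepsilon(\mathcal B_S)$ for all sufficiently small $\varepsilon>0$. -/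

import Mathlib

open MeasureTheory
open scoped ENNReal SchwartzMap

noncomputable section

namespace BesovTikhonov

/-- Euclidean space `ℝ^d`. -/
abbrev Space (d : ℕ) : Type := EuclideanSpace ℝ (Fin d)

/-- Real tempered distributions on `ℝ^d`. -/
abbrev Distr (d : ℕ) : Type := 𝓢(Space d, ℝ) →L[ℝ] ℝ

/-- The indices `λ ∈ Λ` of an inhomogeneous dyadic wavelet basis of `L₂(ℝ^d)`: the integer
translates of the scaling function, and the wavelets of level `j ≥ 0`, type `e` (there are
`2 ^ d - 1` types) and position `k ∈ ℤ^d`. -/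
inductive WaveletIndex (d : ℕ) : Type
  | scaling (k : Fin d → ℤ) : WaveletIndex d
  | detail (j : ℕ) (e : Fin (2 ^ d - 1)) (k : Fin d → ℤ) : WaveletIndex d

/-- The level `|λ|`. -/
def WaveletIndex.level {d : ℕ} : WaveletIndex d → ℕ
  | .scaling _ => 0
  | .detail j _ _ => j

/-- The lattice point `k ∈ ℤ^d` as an element of `ℝ^d`. -/
def latticePoint {d : ℕ} (k : Fin d → ℤ) : Space d := WithLp.toLp 2 (fun i => (k i : ℝ))

/-- `x ↦ 2 ^ (j d / 2) f (2 ^ j x - k)`. -/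
def dilateTranslate {d : ℕ} (f : 𝓢(Space d, ℝ)) (j : ℕ) (k : Fin d → ℤ) : 𝓢(Space d, ℝ) :=
  (2 : ℝ) ^ ((j : ℝ) * d / 2) •
    SchwartzMap.compCLMOfContinuousLinearEquiv ℝ
      (ContinuousLinearEquiv.smulLeft (R₁ := ℝ) (M₁ := Space d)
        (Units.mk0 ((2 : ℝ) ^ j) (pow_ne_zero j two_ne_zero)))
      (SchwartzMap.compSubConstCLM ℝ (latticePoint k) f)

theorem dilateTranslate_apply {d : ℕ} (f : 𝓢(Space d, ℝ)) (j : ℕ) (k : Fin d → ℤ) (x : Space d) :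
    dilateTranslate f j k x =
      (2 : ℝ) ^ ((j : ℝ) * d / 2) * f ((2 : ℝ) ^ j • x - latticePoint k) := rfl

/-- The function `ψ_λ` with index `λ` generated by a scaling function `φ` and wavelets `ψ e`. -/
def waveletAtom {d : ℕ} (φ : 𝓢(Space d, ℝ)) (ψ : Fin (2 ^ d - 1) → 𝓢(Space d, ℝ)) :
    WaveletIndex d → 𝓢(Space d, ℝ)
  | .scaling k => dilateTranslate φ 0 k
  | .detail j e k => dilateTranslate (ψ e) j k

/-- A smooth orthonormal dyadic wavelet basis of `L₂(ℝ^d)` (for instance the Meyer basis): the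
generators are Schwartz functions, all polynomial moments of the wavelets vanish, and the functions
`ψ_λ` form a complete orthonormal system. -/
structure WaveletBasis (d : ℕ) where
  φ : 𝓢(Space d, ℝ)
  ψ : Fin (2 ^ d - 1) → 𝓢(Space d, ℝ)
  moments : ∀ (e : Fin (2 ^ d - 1)) (m : ℕ)
    (L : ContinuousMultilinearMap ℝ (fun _ : Fin m => Space d) ℝ),
    ∫ x : Space d, L (fun _ => x) * ψ e x = 0
  normalized : ∀ i : WaveletIndex d, ∫ x : Space d, waveletAtom φ ψ i x * waveletAtom φ ψ i x = 1
  orthogonal : ∀ i i' : WaveletIndex d, i ≠ i' →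
    ∫ x : Space d, waveletAtom φ ψ i x * waveletAtom φ ψ i' x = 0
  complete : ∀ f : Space d → ℝ, MemLp f 2 volume →
    (∀ i : WaveletIndex d, ∫ x : Space d, f x * waveletAtom φ ψ i x = 0) → f =ᵐ[volume] 0

/-- The wavelet coefficient `u_λ = ⟨u, ψ_λ⟩` of a tempered distribution `u`. -/
def WaveletBasis.coeff {d : ℕ} (W : WaveletBasis d) (u : Distr d) (i : WaveletIndex d) : ℝ :=
  u (waveletAtom W.φ W.ψ i)

/-- The norm of the Besov space `B^s_p = B^s_{p,p}(ℝ^d)`, through wavelet coefficients,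
`(∑_λ 2 ^ (p (s + d (1/2 - 1/p)) |λ|) |u_λ| ^ p) ^ (1/p)`; it is `∞` outside the space.
For `p = 2` it is the norm of the Sobolev space `H^s`. -/
def besovNorm {d : ℕ} (W : WaveletBasis d) (s p : ℝ) (u : Distr d) : ℝ≥0∞ :=
  (∑' i : WaveletIndex d, ENNReal.ofReal
    ((2 : ℝ) ^ (p * (s + d * (1 / 2 - 1 / p)) * (i.level : ℝ)) * |W.coeff u i| ^ p)) ^ (1 / p)

theorem besovNorm_lt_top {d : ℕ} (W : WaveletBasis d) (s p : ℝ) (hp : 0 < p) (u : Distr d) :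
    besovNorm W s p u < ⊤ ↔ (∑' i : WaveletIndex d, ENNReal.ofReal
      ((2 : ℝ) ^ (p * (s + d * (1 / 2 - 1 / p)) * (i.level : ℝ)) * |W.coeff u i| ^ p)) < ⊤ := by
  unfold besovNorm
  rw [ENNReal.rpow_lt_top_iff_of_pos (by positivity)]

/-- The Besov space `B^s_p`, a subspace of the tempered distributions. -/
def besovSpace {d : ℕ} (W : WaveletBasis d) (s p : ℝ) (hp : 0 < p) : Submodule ℝ (Distr d) where
  carrier := {u | besovNorm W s p u < ⊤}
  zero_mem' := by
    rw [Set.mem_ofPred_eq, besovNorm_lt_top W s p hp]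
    simp [WaveletBasis.coeff, Real.zero_rpow hp.ne']
  add_mem' := by
    intro u v hu hv
    rw [Set.mem_ofPred_eq, besovNorm_lt_top W s p hp] at hu hv ⊢
    have key : ∀ a b : ℝ, |a + b| ^ p ≤ 2 ^ p * (|a| ^ p + |b| ^ p) := by
      intro a b
      have hm : |a + b| ≤ 2 * max |a| |b| := by
        have h1 := abs_add_le a b
        have h2 := le_max_left |a| |b|
        have h3 := le_max_right |a| |b|
        linarith
      calc |a + b| ^ p ≤ (2 * max |a| |b|) ^ p := Real.rpow_le_rpow (abs_nonneg _) hm hp.le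
        _ = 2 ^ p * (max |a| |b|) ^ p := Real.mul_rpow (by norm_num) (by positivity)
        _ ≤ 2 ^ p * (|a| ^ p + |b| ^ p) := by
          gcongr
          have ha : 0 ≤ |a| ^ p := by positivity
          have hb : 0 ≤ |b| ^ p := by positivity
          rcases max_choice |a| |b| with h | h <;> rw [h] <;> linarith
    refine lt_of_le_of_lt (ENNReal.tsum_le_tsum (g := fun i : WaveletIndex d =>
      ENNReal.ofReal (2 ^ p) * (ENNReal.ofReal
        ((2 : ℝ) ^ (p * (s + d * (1 / 2 - 1 / p)) * (i.level : ℝ)) * |W.coeff u i| ^ p) +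
        ENNReal.ofReal
        ((2 : ℝ) ^ (p * (s + d * (1 / 2 - 1 / p)) * (i.level : ℝ)) * |W.coeff v i| ^ p)))
      fun i => ?_) ?_
    · rw [← ENNReal.ofReal_add (by positivity) (by positivity),
        ← ENNReal.ofReal_mul (by positivity)]
      apply ENNReal.ofReal_le_ofReal
      have h := key (W.coeff u i) (W.coeff v i)
      have hc : W.coeff (u + v) i = W.coeff u i + W.coeff v i := rfl
      rw [hc]
      calc _ ≤ (2 : ℝ) ^ (p * (s + d * (1 / 2 - 1 / p)) * (i.level : ℝ)) *
            (2 ^ p * (|W.coeff u i| ^ p + |W.coeff v i| ^ p)) := by gcongr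
        _ = _ := by ring
    · rw [ENNReal.tsum_mul_left, ENNReal.tsum_add]
      exact ENNReal.mul_lt_top ENNReal.ofReal_lt_top (ENNReal.add_lt_top.2 ⟨hu, hv⟩)
  smul_mem' := by
    intro c u hu
    rw [Set.mem_ofPred_eq, besovNorm_lt_top W s p hp] at hu ⊢
    have h : ∀ i : WaveletIndex d, ENNReal.ofReal
        ((2 : ℝ) ^ (p * (s + d * (1 / 2 - 1 / p)) * (i.level : ℝ)) * |W.coeff (c • u) i| ^ p) =
        ENNReal.ofReal (|c| ^ p) * ENNReal.ofReal
        ((2 : ℝ) ^ (p * (s + d * (1 / 2 - 1 / p)) * (i.level : ℝ)) * |W.coeff u i| ^ p) := by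
      intro i
      have hc : W.coeff (c • u) i = c * W.coeff u i := rfl
      rw [hc, abs_mul, Real.mul_rpow (abs_nonneg _) (abs_nonneg _),
        ← ENNReal.ofReal_mul (by positivity)]
      congr 1
      ring
    rw [tsum_congr h, ENNReal.tsum_mul_left]
    exact ENNReal.mul_lt_top ENNReal.ofReal_lt_top hu

/-- The data space `L₂(ℝ^d)`. -/
abbrev L2 (d : ℕ) : Type := Lp ℝ 2 (volume : Measure (Space d))

section Operator

variable {d : ℕ} {W : WaveletBasis d} {sD pD : ℝ} {hD : 0 < pD}

/-- Continuity of a linear operator `B_D → L₂`. -/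
def IsBounded (F : besovSpace W sD pD hD →ₗ[ℝ] L2 d) : Prop :=
  ∃ C : ℝ, 0 ≤ C ∧ ∀ u : besovSpace W sD pD hD,
    ENNReal.ofReal ‖F u‖ ≤ ENNReal.ofReal C * besovNorm W sD pD (u : Distr d)

/-- `rg F* ⊆ B_D*` as a set of distributions: `g` belongs to it if for some `w ∈ L₂` the functional
`F* w : u ↦ ⟨w, F u⟩` on `B_D` is the duality pairing `u ↦ ∑_λ g_λ u_λ` with `g`. -/
def adjointRange (F : besovSpace W sD pD hD →ₗ[ℝ] L2 d) : Set (Distr d) :=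
  {g | ∃ w : L2 d, ∀ u : besovSpace W sD pD hD,
    HasSum (fun i => W.coeff g i * W.coeff (u : Distr d) i) (inner ℝ w (F u))}

/-- The Tikhonov functional `T_α(u) = ‖F u - y‖² + α ‖u‖_{B_R} ^ p_R`, with values in `[0, ∞]`. -/
def tikhonov (F : besovSpace W sD pD hD →ₗ[ℝ] L2 d) (sR pR α : ℝ) (y : L2 d)
    (u : besovSpace W sD pD hD) : ℝ≥0∞ :=
  ENNReal.ofReal (‖F u - y‖ ^ 2) + ENNReal.ofReal α * besovNorm W sR pR (u : Distr d) ^ pR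

/-- `u ∈ argmin T_α` over `B_D`. -/
def IsTikhonovMinimizer (F : besovSpace W sD pD hD →ₗ[ℝ] L2 d) (sR pR α : ℝ) (y : L2 d)
    (u : besovSpace W sD pD hD) : Prop :=
  ∀ u' : besovSpace W sD pD hD, tikhonov F sR pR α y u ≤ tikhonov F sR pR α y u'

/-- The convergence rate `‖u^{α,δ} - u†‖_{H^σ} = O(√δ)` as `δ → 0`, for every minimizer
`u^{α,δ}` of the Tikhonov functional with the penalty `‖·‖_{B_R} ^ p_R`, exact data `F u†`, noisy
data of noise level `δ`, and the parameter rule `α ≍ δ`, that is `a δ ≤ α ≤ b δ`. -/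
def ConvergenceRate (F : besovSpace W sD pD hD →ₗ[ℝ] L2 d) (uDag : besovSpace W sD pD hD)
    (sR pR σ : ℝ) : Prop :=
  ∀ a b : ℝ, 0 < a → 0 < b → ∃ K δ₀ : ℝ, 0 < K ∧ 0 < δ₀ ∧
    ∀ δ : ℝ, 0 < δ → δ < δ₀ → ∀ α : ℝ, a * δ ≤ α → α ≤ b * δ →
      ∀ y : L2 d, ‖F uDag - y‖ ≤ δ →
        ∀ u : besovSpace W sD pD hD, IsTikhonovMinimizer F sR pR α y u →
          besovNorm W σ 2 ((u : Distr d) - (uDag : Distr d)) ≤ ENNReal.ofReal (K * √δ)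

end Operator

/-- The bound on the smoothness `s_R` of the penalty for the parameter `p`. -/
def smoothnessBound (d : ℕ) (sS pS sG pG ε p : ℝ) : ℝ :=
  (p * sS - pG * sG) / (p + pG) - d * (1 / (p + pG) * (p / pS - 1)) - ε * (p / pS - 1)

/-- The penalties `‖·‖_{B_R} ^ p_R` allowed by the weakened source conditions. -/
def AllowedPenalty (d : ℕ) (sS pS pD sG pG ε sR pR : ℝ) : Prop :=
  ∃ p : ℝ, 0 < p ∧ pS ≤ p ∧ p ≤ min pD pG ∧
    pR = (p + pG) / pG ∧ sR ≤ smoothnessBound d sS pS sG pG ε p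

/-- The exponent `σ = s_R + d (1/2 - 1/p_R)` of the Sobolev space of the convergence rate. -/
def rateExponent (d : ℕ) (sR pR : ℝ) : ℝ := sR + d * (1 / 2 - 1 / pR)

/-- `p_R` for the choice `p = min {p_D, p_G}`. -/
def optP (pD pG : ℝ) : ℝ := (min pD pG + pG) / pG

/-- `s_R` for the choice `p = min {p_D, p_G}`. -/
def optS (d : ℕ) (sS pS pD sG pG ε : ℝ) : ℝ := smoothnessBound d sS pS sG pG ε (min pD pG)

/-- `σ` for the choice `p = min {p_D, p_G}`, as a function of the source space `B^{s_S}_{p_S}`. -/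
def optRate (d : ℕ) (pD sG pG ε sS pS : ℝ) : ℝ :=
  rateExponent d (optS d sS pS pD sG pG ε) (optP pD pG)

end BesovTikhonov

end

/-!
Write `R` for the penalty `‖·‖^{p_R}` of `B^{s_R}_{p_R}`. If the derivative `R'(u†)` lies in
`rg F*`, then comparing the Tikhonov functional at a minimizer with its value at `u†`, for `α ~ δ`,
bounds the Bregman distance of `R` between the two by a multiple of `δ`. Since `1 < p_R ≤ 2`, the
function `|t|^{p_R}` is strongly convex on bounded intervals, and the weighted wavelet coefficients
of the minimizers stay bounded. Hence the Bregman distance dominates the square of a weighted `ℓ²`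
distance, which is the norm of `H^σ` with `σ = s_R + d (1/2 - 1/p_R)`: this is the rate `√δ`.

For `u† ∈ B_S`, condition (1) is the linear inequality between the weight exponents under which the
coefficients of `R'(u†)` belong to the sequence space of `B_G`. They are the coefficients of a
tempered distribution, because vanishing moments and Taylor's formula make the wavelet coefficients
of Schwartz functions decay faster than any power of `2^{-|λ|}`. Thus `R'(u†) ∈ B_G ⊆ rg F*`.

With equality in (1), `σ` is a Möbius function of `p` minus the linear loss `ε (p/p_S - 1)`. The
embeddings of `B_S` and `B_G` make the Möbius part increase, with a slope bounded below on the
range of `p`, so for small `ε` the largest admissible `p` is optimal.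
-/

open scoped NNReal

noncomputable section

namespace BesovTikhonov

section Taylor

variable {E F : Type*} [NormedAddCommGroup E] [NormedAddCommGroup F]

theorem inv_one_add_norm_add_pow_le (x z : E) (M : ℕ) :
    ((1 + ‖x + z‖) ^ M)⁻¹ ≤ (1 + ‖z‖) ^ M * ((1 + ‖x‖) ^ M)⁻¹ := by
  rw [← div_eq_mul_inv, le_div_iff₀ (by positivity), inv_mul_le_iff₀ (by positivity), ← mul_pow]
  refine pow_le_pow_left₀ (by positivity) ?_ M
  have hx : ‖x‖ ≤ ‖x + z‖ + ‖z‖ := by simpa using norm_sub_le (x + z) z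
  nlinarith [norm_nonneg (x + z), norm_nonneg z, mul_nonneg (norm_nonneg (x + z)) (norm_nonneg z)]

variable [NormedSpace ℝ E] [NormedSpace ℝ F]

theorem norm_sub_taylor_le [CompleteSpace F] {f : E → F} {n : ℕ} (hf : ContDiff ℝ (n + 1) f)
    (x y : E) {B : ℝ}
    (hB : ∀ t ∈ Set.Icc (0 : ℝ) 1, ‖iteratedFDeriv ℝ (n + 1) f (x + t • y)‖ ≤ B) :
    ‖f (x + y) - ∑ m ∈ Finset.range (n + 1),
      (m.factorial : ℝ)⁻¹ • iteratedFDeriv ℝ m f x (fun _ => y)‖ ≤ B * ‖y‖ ^ (n + 1) := by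
  rw [map_add_eq_sum_add_integral_iteratedFDeriv fun t _ => hf.contDiffAt, add_sub_cancel_left,
    norm_smul]
  have hfactorial : ‖(n.factorial : ℝ)⁻¹‖ ≤ 1 := by
    rw [norm_inv, Real.norm_natCast]
    exact inv_le_one_of_one_le₀ (by exact_mod_cast n.factorial_pos)
  have hintegrand : ∀ t ∈ Set.uIoc (0 : ℝ) 1,
      ‖(1 - t) ^ n • iteratedFDeriv ℝ (n + 1) f (x + t • y) (fun _ => y)‖ ≤
        B * ‖y‖ ^ (n + 1) := by
    intro t ht
    rw [Set.uIoc_of_le zero_le_one] at ht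
    have hweight : ‖(1 - t) ^ n‖ ≤ 1 := by
      rw [norm_pow]
      exact pow_le_one₀ (norm_nonneg _) (abs_le.2 ⟨by linarith [ht.2], by linarith [ht.1]⟩)
    have hderiv : ‖iteratedFDeriv ℝ (n + 1) f (x + t • y) (fun _ => y)‖ ≤ B * ‖y‖ ^ (n + 1) :=
      ((iteratedFDeriv ℝ (n + 1) f (x + t • y)).le_opNorm_mul_pow_of_le (pi_norm_const_le y)).trans
        (mul_le_mul_of_nonneg_right (hB t ⟨ht.1.le, ht.2⟩) (by positivity))
    rw [norm_smul]
    exact (mul_le_of_le_one_left (norm_nonneg _) hweight).trans hderiv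
  refine (mul_le_of_le_one_left (norm_nonneg _) hfactorial).trans ?_
  simpa using intervalIntegral.norm_integral_le_of_norm_le_const hintegrand

/-- The Schwartz seminorm `2 ^ M sup_{k ≤ M, m ≤ N} sup_x ‖x‖ ^ k ‖D^m f x‖`; it dominates
`(1 + ‖x‖) ^ M ‖D^m f x‖` for all `m ≤ N`. -/
def decaySeminorm (M N : ℕ) : Seminorm ℝ 𝓢(E, F) :=
  (2 ^ M : ℝ≥0) • (Finset.Iic (M, N)).sup (schwartzSeminormFamily ℝ E F)

theorem norm_iteratedFDeriv_le_decaySeminorm (M : ℕ) {N m : ℕ} (hm : m ≤ N) (f : 𝓢(E, F))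
    (x : E) :
    ‖iteratedFDeriv ℝ m f x‖ ≤ decaySeminorm M N f * ((1 + ‖x‖) ^ M)⁻¹ := by
  rw [← div_eq_mul_inv, le_div_iff₀ (by positivity), mul_comm]
  exact SchwartzMap.one_add_le_sup_seminorm_apply (𝕜 := ℝ) (m := (M, N)) le_rfl hm f x

theorem norm_le_decaySeminorm (M N : ℕ) (f : 𝓢(E, F)) (x : E) :
    ‖f x‖ ≤ decaySeminorm M N f * ((1 + ‖x‖) ^ M)⁻¹ := by
  simpa using norm_iteratedFDeriv_le_decaySeminorm M (Nat.zero_le N) f x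

theorem norm_sub_taylor_le_decaySeminorm [CompleteSpace F] (M n : ℕ) (f : 𝓢(E, F)) (x z : E) :
    ‖f (x + z) - ∑ m ∈ Finset.range (n + 1),
      (m.factorial : ℝ)⁻¹ • iteratedFDeriv ℝ m f x (fun _ => z)‖ ≤
      decaySeminorm M (n + 1) f * ((1 + ‖z‖) ^ M * ((1 + ‖x‖) ^ M)⁻¹) * ‖z‖ ^ (n + 1) := by
  refine norm_sub_taylor_le (f.smooth _) x z fun t ht => ?_
  have htz : ‖t • z‖ ≤ ‖z‖ := by
    rw [norm_smul, Real.norm_of_nonneg ht.1]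
    exact mul_le_of_le_one_left (norm_nonneg z) ht.2
  calc ‖iteratedFDeriv ℝ (n + 1) f (x + t • z)‖
      ≤ decaySeminorm M (n + 1) f * ((1 + ‖x + t • z‖) ^ M)⁻¹ :=
        norm_iteratedFDeriv_le_decaySeminorm M le_rfl f _
    _ ≤ decaySeminorm M (n + 1) f * ((1 + ‖t • z‖) ^ M * ((1 + ‖x‖) ^ M)⁻¹) := by
        gcongr
        exact inv_one_add_norm_add_pow_le x (t • z) M
    _ ≤ decaySeminorm M (n + 1) f * ((1 + ‖z‖) ^ M * ((1 + ‖x‖) ^ M)⁻¹) := by gcongr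

end Taylor

section Moments

variable {E : Type*} [NormedAddCommGroup E] [MeasurableSpace E]

/-- The absolute moment `∫ (1 + ‖y‖) ^ m |η y| dμ`. -/
def absMoment (μ : Measure E) (m : ℕ) (η : E → ℝ) : ℝ := ∫ y, (1 + ‖y‖) ^ m * |η y| ∂μ

theorem absMoment_nonneg (μ : Measure E) (m : ℕ) (η : E → ℝ) : 0 ≤ absMoment μ m η :=
  integral_nonneg fun _ => by positivity

variable [NormedSpace ℝ E]

/-- All polynomial moments of `η` vanish. A homogeneous polynomial of degree `m` is encoded as the
diagonal of a multilinear form, as in `WaveletBasis.moments`. -/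
def HasVanishingMoments (μ : Measure E) (η : E → ℝ) : Prop :=
  ∀ (m : ℕ) (L : ContinuousMultilinearMap ℝ (fun _ : Fin m => E) ℝ),
    ∫ x, L (fun _ => x) * η x ∂μ = 0

theorem HasVanishingMoments.integral_mul_eq {μ : Measure E} {η f : E → ℝ}
    (hη : HasVanishingMoments μ η) (hf : Integrable (fun y => f y * η y) μ) (s : Finset ℕ)
    (L : ∀ m : ℕ, ContinuousMultilinearMap ℝ (fun _ : Fin m => E) ℝ)
    (hL : ∀ m ∈ s, Integrable (fun y => L m (fun _ => y) * η y) μ) :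
    ∫ y, f y * η y ∂μ = ∫ y, (f y - ∑ m ∈ s, L m (fun _ => y)) * η y ∂μ := by
  simp only [sub_mul, Finset.sum_mul]
  rw [integral_sub hf (integrable_finsetSum _ hL), integral_finsetSum _ hL,
    Finset.sum_eq_zero fun m _ => hη m (L m), sub_zero]

variable [BorelSpace E] [SecondCountableTopology E] {μ : Measure E} [μ.HasTemperateGrowth]

theorem integrable_one_add_norm_pow_mul_abs (η : 𝓢(E, ℝ)) (m : ℕ) :
    Integrable (fun y => (1 + ‖y‖) ^ m * |η y|) μ := by
  have hsum := (η.integrable_pow_mul μ 0).add (η.integrable_pow_mul μ m)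
  refine (hsum.const_mul (2 ^ (m - 1))).mono' (by fun_prop)
    (Filter.Eventually.of_forall fun y => ?_)
  rw [Real.norm_of_nonneg (by positivity)]
  calc (1 + ‖y‖) ^ m * |η y| ≤ 2 ^ (m - 1) * (1 ^ m + ‖y‖ ^ m) * |η y| := by
        gcongr
        exact add_pow_le zero_le_one (norm_nonneg y) m
    _ = 2 ^ (m - 1) * (‖y‖ ^ 0 * ‖η y‖ + ‖y‖ ^ m * ‖η y‖) := by
        rw [Real.norm_eq_abs]
        ring

theorem integrable_multilinear_diag_mul {m : ℕ}
    (L : ContinuousMultilinearMap ℝ (fun _ : Fin m => E) ℝ) (η : 𝓢(E, ℝ)) :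
    Integrable (fun y => L (fun _ => y) * η y) μ := by
  have hcont : Continuous fun y : E => L (fun _ => y) := by fun_prop
  refine ((η.integrable_pow_mul μ m).const_mul ‖L‖).mono'
    (hcont.mul η.continuous).aestronglyMeasurable (Filter.Eventually.of_forall fun y => ?_)
  rw [norm_mul, ← mul_assoc]
  gcongr
  exact L.le_opNorm_mul_pow_of_le (pi_norm_const_le y)

theorem integrable_comp_add_smul_mul (f η : 𝓢(E, ℝ)) (x : E) (h : ℝ) :
    Integrable (fun y => f (x + h • y) * η y) μ :=
  η.integrable.bdd_mul (c := decaySeminorm 0 0 f) (by fun_prop)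
    (Filter.Eventually.of_forall fun y => by
      simpa using norm_le_decaySeminorm 0 0 f (x + h • y))

theorem abs_integral_comp_add_mul_le (f η : 𝓢(E, ℝ)) (x : E) (M N : ℕ) :
    |∫ y, f (x + y) * η y ∂μ| ≤
      absMoment μ M η * decaySeminorm M N f * ((1 + ‖x‖) ^ M)⁻¹ := by
  rw [mul_assoc, absMoment, ← integral_mul_const, ← Real.norm_eq_abs]
  refine norm_integral_le_of_norm_le ((integrable_one_add_norm_pow_mul_abs η M).mul_const _)
    (Filter.Eventually.of_forall fun y => ?_)
  calc ‖f (x + y) * η y‖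
      ≤ decaySeminorm M N f * ((1 + ‖x + y‖) ^ M)⁻¹ * |η y| := by
        rw [norm_mul, ← Real.norm_eq_abs]
        gcongr
        exact norm_le_decaySeminorm M N f (x + y)
    _ ≤ decaySeminorm M N f * ((1 + ‖y‖) ^ M * ((1 + ‖x‖) ^ M)⁻¹) * |η y| := by
        gcongr
        exact inv_one_add_norm_add_pow_le x y M
    _ = (1 + ‖y‖) ^ M * |η y| * (decaySeminorm M N f * ((1 + ‖x‖) ^ M)⁻¹) := by ring

-- Vanishing moments annihilate the Taylor polynomial of `f` at `x`, so only the remainder counts.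
theorem abs_integral_comp_add_smul_mul_le (f η : 𝓢(E, ℝ)) (hη : HasVanishingMoments μ η) (M n : ℕ)
    (x : E) {h : ℝ} (h0 : 0 ≤ h) (h1 : h ≤ 1) :
    |∫ y, f (x + h • y) * η y ∂μ| ≤
      absMoment μ (M + (n + 1)) η * decaySeminorm M (n + 1) f *
        (h ^ (n + 1) * ((1 + ‖x‖) ^ M)⁻¹) := by
  let L (m : ℕ) : ContinuousMultilinearMap ℝ (fun _ : Fin m => E) ℝ :=
    ((m.factorial : ℝ)⁻¹ * h ^ m) • iteratedFDeriv ℝ m f x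
  have hL (m : ℕ) (y : E) : L m (fun _ => y) =
      (m.factorial : ℝ)⁻¹ • iteratedFDeriv ℝ m f x (fun _ => h • y) := by
    rw [ContinuousMultilinearMap.map_smul_univ (iteratedFDeriv ℝ m f x) (fun _ => h)]
    simp [L, mul_assoc]
  rw [hη.integral_mul_eq (integrable_comp_add_smul_mul f η x h) (Finset.range (n + 1)) L
    fun m _ => integrable_multilinear_diag_mul (L m) η]
  simp only [hL]
  rw [mul_assoc, absMoment, ← integral_mul_const, ← Real.norm_eq_abs]
  refine norm_integral_le_of_norm_le ((integrable_one_add_norm_pow_mul_abs η _).mul_const _)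
    (Filter.Eventually.of_forall fun y => ?_)
  have hnorm : ‖h • y‖ = h * ‖y‖ := by rw [norm_smul, Real.norm_of_nonneg h0]
  have hle : ‖h • y‖ ≤ ‖y‖ := hnorm.trans_le (mul_le_of_le_one_left (norm_nonneg y) h1)
  rw [norm_mul, Real.norm_eq_abs (η y)]
  calc _ ≤ decaySeminorm M (n + 1) f * ((1 + ‖h • y‖) ^ M * ((1 + ‖x‖) ^ M)⁻¹) *
        ‖h • y‖ ^ (n + 1) * |η y| := by
        gcongr
        exact norm_sub_taylor_le_decaySeminorm M n f x (h • y)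
    _ ≤ decaySeminorm M (n + 1) f * ((1 + ‖y‖) ^ M * ((1 + ‖x‖) ^ M)⁻¹) *
        (h * (1 + ‖y‖)) ^ (n + 1) * |η y| := by
        gcongr
        rw [hnorm]
        gcongr
        linarith
    _ = (1 + ‖y‖) ^ (M + (n + 1)) * |η y| *
        (decaySeminorm M (n + 1) f * (h ^ (n + 1) * ((1 + ‖x‖) ^ M)⁻¹)) := by
        rw [mul_pow, pow_add]
        ring

end Moments

section Synthesis

variable {d : ℕ}

theorem integral_mul_dilateTranslate (f : Space d → ℝ) (η : 𝓢(Space d, ℝ)) (j : ℕ)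
    (k : Fin d → ℤ) :
    ∫ x, f x * dilateTranslate η j k x =
      (2 : ℝ) ^ ((j : ℝ) * d / 2) * (((2 : ℝ) ^ j) ^ d)⁻¹ *
        ∫ y, f (((2 : ℝ) ^ j)⁻¹ • latticePoint k + ((2 : ℝ) ^ j)⁻¹ • y) * η y := by
  set c : ℝ := 2 ^ j with hc
  have hc0 : 0 < c := by positivity
  let g (z : Space d) : ℝ := f (c⁻¹ • z) * η (z - latticePoint k)
  have hdilate : ∫ x, g (c • x) = (c ^ d)⁻¹ * ∫ z, g z := by
    rw [Measure.integral_comp_smul, finrank_euclideanSpace, Fintype.card_fin,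
      abs_of_pos (by positivity), smul_eq_mul]
  calc ∫ x, f x * dilateTranslate η j k x
      = (2 : ℝ) ^ ((j : ℝ) * d / 2) * ∫ x, g (c • x) := by
        rw [← integral_const_mul]
        congr 1 with x
        simp only [dilateTranslate_apply, ← hc, g, inv_smul_smul₀ hc0.ne']
        ring
    _ = (2 : ℝ) ^ ((j : ℝ) * d / 2) * (c ^ d)⁻¹ * ∫ y, g (y + latticePoint k) := by
        rw [hdilate, mul_assoc, integral_add_right_eq_self g]
    _ = _ := by simp only [g, add_sub_cancel_right, smul_add, add_comm]

theorem abs_integral_mul_dilateTranslate_le (f : Space d → ℝ) (η : 𝓢(Space d, ℝ)) (j : ℕ)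
    (k : Fin d → ℤ) :
    |∫ x, f x * dilateTranslate η j k x| ≤
      |∫ y, f (((2 : ℝ) ^ j)⁻¹ • latticePoint k + ((2 : ℝ) ^ j)⁻¹ • y) * η y| := by
  have hfactor : (2 : ℝ) ^ ((j : ℝ) * d / 2) * (((2 : ℝ) ^ j) ^ d)⁻¹ ≤ 1 := by
    rw [← div_eq_mul_inv, div_le_one (by positivity), ← pow_mul, ← Real.rpow_natCast]
    refine Real.rpow_le_rpow_of_exponent_le one_le_two ?_
    push_cast
    exact half_le_self (by positivity)
  rw [integral_mul_dilateTranslate, abs_mul, abs_of_nonneg (by positivity)]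
  exact mul_le_of_le_one_left (abs_nonneg _) hfactor

theorem abs_integral_mul_translate_le (f η : 𝓢(Space d, ℝ)) (M N : ℕ) (k : Fin d → ℤ) :
    |∫ x, f x * dilateTranslate η 0 k x| ≤
      absMoment volume M η * decaySeminorm M N f * ((1 + ‖latticePoint k‖) ^ M)⁻¹ :=
  (abs_integral_mul_dilateTranslate_le f η 0 k).trans
    (by simpa using abs_integral_comp_add_mul_le f η (latticePoint k) M N)

theorem abs_integral_mul_dilateTranslate_le_of_moments (f η : 𝓢(Space d, ℝ))
    (hη : HasVanishingMoments volume η) (M n j : ℕ) (k : Fin d → ℤ) :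
    |∫ x, f x * dilateTranslate η j k x| ≤
      absMoment volume (M + (M + n + 1)) η * decaySeminorm M (M + n + 1) f *
        (((1 / 2 : ℝ) ^ j) ^ (n + 1) * ((1 + ‖latticePoint k‖) ^ M)⁻¹) := by
  refine (abs_integral_mul_dilateTranslate_le f η j k).trans ?_
  rw [← inv_pow, ← one_div]
  set h : ℝ := (1 / 2) ^ j
  have h0 : 0 < h := by positivity
  have h1 : h ≤ 1 := pow_le_one₀ (by norm_num) (by norm_num)
  refine (abs_integral_comp_add_smul_mul_le f η hη M (M + n) _ h0.le h1).trans ?_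
  have hmoment := absMoment_nonneg volume (M + (M + n + 1)) η
  refine mul_le_mul_of_nonneg_left ?_ (mul_nonneg hmoment (apply_nonneg _ f))
  have hscale : h * (1 + ‖latticePoint k‖) ≤ 1 + ‖h • latticePoint k‖ := by
    rw [norm_smul, Real.norm_of_nonneg h0.le]
    linarith
  calc h ^ (M + n + 1) * ((1 + ‖h • latticePoint k‖) ^ M)⁻¹
      ≤ h ^ (M + n + 1) * ((h * (1 + ‖latticePoint k‖)) ^ M)⁻¹ := by gcongr
    _ = h ^ (n + 1) * ((1 + ‖latticePoint k‖) ^ M)⁻¹ := by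
        rw [mul_pow, add_assoc, pow_add]
        field_simp

theorem latticePoint_mem_span_basisFun (k : Fin d → ℤ) :
    latticePoint k ∈
      Submodule.span ℤ (Set.range (EuclideanSpace.basisFun (Fin d) ℝ).toBasis) := by
  rw [Module.Basis.mem_span_iff_repr_mem]
  exact fun i => ⟨k i, by simp [latticePoint]⟩

theorem latticePoint_injective : Function.Injective (latticePoint (d := d)) := fun k l hkl =>
  funext fun i => by simpa [latticePoint] using congrArg (fun x : Space d => x i) hkl

theorem summable_one_add_norm_latticePoint_pow_inv (d : ℕ) :
    Summable fun k : Fin d → ℤ => ((1 + ‖latticePoint k‖) ^ (d + 1))⁻¹ := by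
  set L := Submodule.span ℤ (Set.range (EuclideanSpace.basisFun (Fin d) ℝ).toBasis)
  let point (k : Fin d → ℤ) : L := ⟨latticePoint k, latticePoint_mem_span_basisFun k⟩
  have hpoint : Function.Injective point := fun k l hkl =>
    latticePoint_injective (congrArg Subtype.val hkl)
  have hrank : Module.finrank ℤ L < d + 1 := by
    rw [ZLattice.rank ℝ L, finrank_euclideanSpace_fin]
    exact d.lt_succ_self
  refine Summable.of_norm_bounded_eventually
    ((ZLattice.summable_norm_pow_inv L (d + 1) hrank).comp_injective hpoint) ?_
  filter_upwards [(Set.finite_singleton (0 : Fin d → ℤ)).compl_mem_cofinite] with k hk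
  have hk0 : 0 < ‖latticePoint k‖ := by
    rw [norm_pos_iff]
    exact fun h => hk (latticePoint_injective (h.trans (by ext i; simp [latticePoint])))
  rw [Real.norm_of_nonneg (by positivity)]
  simp only [Function.comp_apply, point, Submodule.coe_norm, inv_pow]
  gcongr
  linarith

namespace WaveletIndex

/-- A summable weight on the wavelet indices which, up to constants, dominates the wavelet
coefficients of every Schwartz function, even when these are multiplied by `2 ^ (n |λ|)`. -/
def decay : WaveletIndex d → ℝ
  | .scaling k => ((1 + ‖latticePoint k‖) ^ (d + 1))⁻¹
  | .detail j _ k => (1 / 2) ^ j * ((1 + ‖latticePoint k‖) ^ (d + 1))⁻¹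

theorem decay_nonneg (i : WaveletIndex d) : 0 ≤ i.decay := by
  cases i <;> simp only [decay] <;> positivity

/-- The wavelet indices as a disjoint union of products, for summation over them. -/
def sumEquiv (d : ℕ) :
    (Fin d → ℤ) ⊕ ((ℕ × Fin (2 ^ d - 1)) × (Fin d → ℤ)) ≃ WaveletIndex d where
  toFun
    | .inl k => .scaling k
    | .inr ((j, e), k) => .detail j e k
  invFun
    | .scaling k => .inl k
    | .detail j e k => .inr ((j, e), k)
  left_inv := by rintro (k | ⟨⟨j, e⟩, k⟩) <;> rfl
  right_inv := by rintro (k | ⟨j, e, k⟩) <;> rfl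

theorem summable_decay (d : ℕ) : Summable (decay (d := d)) := by
  rw [← (sumEquiv d).summable_iff]
  have hlattice := summable_one_add_norm_latticePoint_pow_inv d
  have hlevels : Summable fun x : ℕ × Fin (2 ^ d - 1) => ((1 : ℝ) / 2) ^ x.1 * 1 :=
    summable_geometric_two.mul_of_nonneg
      (Summable.of_finite : Summable fun _ : Fin (2 ^ d - 1) => (1 : ℝ))
      (fun _ => by positivity) fun _ => zero_le_one
  refine Summable.sum _ hlattice ?_
  refine (hlevels.mul_of_nonneg hlattice (fun _ => by positivity) fun _ => by positivity).congr ?_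
  exact fun x => by simp [sumEquiv, decay]

/-- The coefficients `ξ` grow at most exponentially in the level, that is, polynomially in the
frequency `2 ^ |λ|`. These are the sequences for which `∑_λ ξ_λ ψ_λ` converges as a tempered
distribution. -/
def IsTempered (ξ : WaveletIndex d → ℝ) : Prop :=
  ∃ (C : ℝ) (n : ℕ), ∀ i, |ξ i| ≤ C * 2 ^ (n * i.level)

end WaveletIndex

namespace WaveletBasis

theorem integrable_mul_waveletAtom (W : WaveletBasis d) (f : 𝓢(Space d, ℝ))
    (i : WaveletIndex d) : Integrable fun x => f x * waveletAtom W.φ W.ψ i x :=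
  (f.memLp 2 volume).integrable_mul ((waveletAtom W.φ W.ψ i).memLp 2 volume)

theorem exists_abs_integral_waveletAtom_le (W : WaveletBasis d) (n : ℕ) :
    ∃ K : ℝ, 0 ≤ K ∧ ∀ (f : 𝓢(Space d, ℝ)) (i : WaveletIndex d),
      2 ^ (n * i.level) * |∫ x, f x * waveletAtom W.φ W.ψ i x| ≤
        K * decaySeminorm (d + 1) (d + 1 + n + 1) f * i.decay := by
  let A (η : 𝓢(Space d, ℝ)) (m : ℕ) : ℝ := absMoment volume m η
  have hA (η : 𝓢(Space d, ℝ)) (m : ℕ) : 0 ≤ A η m := absMoment_nonneg volume m η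
  let m := d + 1 + (d + 1 + n + 1)
  have hAψ : 0 ≤ ∑ e, A (W.ψ e) m := Finset.sum_nonneg fun e _ => hA _ _
  refine ⟨A W.φ (d + 1) + ∑ e, A (W.ψ e) m, add_nonneg (hA _ _) hAψ, fun f i => ?_⟩
  rcases i with k | ⟨j, e, k⟩
  · simp only [WaveletIndex.level, WaveletIndex.decay, waveletAtom, mul_zero, pow_zero, one_mul]
    refine (abs_integral_mul_translate_le f W.φ (d + 1) (d + 1 + n + 1) k).trans ?_
    gcongr
    exact le_add_of_nonneg_right hAψ
  · simp only [WaveletIndex.level, WaveletIndex.decay, waveletAtom]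
    have hmoment : A (W.ψ e) m ≤ A W.φ (d + 1) + ∑ e, A (W.ψ e) m :=
      (Finset.single_le_sum (fun e _ => hA (W.ψ e) m) (Finset.mem_univ e)).trans
        (le_add_of_nonneg_left (hA _ _))
    have hlevel : (2 : ℝ) ^ (n * j) * ((1 / 2 : ℝ) ^ j) ^ (n + 1) = (1 / 2) ^ j := by
      rw [mul_comm n j, pow_mul, pow_succ, ← mul_assoc, ← mul_pow, ← mul_pow]
      norm_num
    calc _ ≤ 2 ^ (n * j) * (A (W.ψ e) m * decaySeminorm (d + 1) (d + 1 + n + 1) f *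
          (((1 / 2 : ℝ) ^ j) ^ (n + 1) * ((1 + ‖latticePoint k‖) ^ (d + 1))⁻¹)) := by
          gcongr
          exact abs_integral_mul_dilateTranslate_le_of_moments f (W.ψ e) (W.moments e) _ n j k
      _ = A (W.ψ e) m * decaySeminorm (d + 1) (d + 1 + n + 1) f *
          ((2 ^ (n * j) * ((1 / 2 : ℝ) ^ j) ^ (n + 1)) *
            ((1 + ‖latticePoint k‖) ^ (d + 1))⁻¹) := by ring
      _ ≤ _ := by
          rw [hlevel]
          gcongr

end WaveletBasis

theorem WaveletIndex.IsTempered.exists_norm_mul_integral_le (W : WaveletBasis d)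
    {ξ : WaveletIndex d → ℝ} (hξ : WaveletIndex.IsTempered ξ) :
    ∃ (K : ℝ) (N : ℕ), 0 ≤ K ∧ ∀ (f : 𝓢(Space d, ℝ)) (i : WaveletIndex d),
      ‖ξ i * ∫ x, f x * waveletAtom W.φ W.ψ i x‖ ≤
        K * decaySeminorm (d + 1) N f * i.decay := by
  obtain ⟨C, n, hξ⟩ := hξ
  obtain ⟨K, hK, hdecay⟩ := W.exists_abs_integral_waveletAtom_le n
  have hC : 0 ≤ C := by simpa [WaveletIndex.level] using (abs_nonneg _).trans (hξ (.scaling 0))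
  refine ⟨C * K, d + 1 + n + 1, mul_nonneg hC hK, fun f i => ?_⟩
  set c := ∫ x, f x * waveletAtom W.φ W.ψ i x
  calc ‖ξ i * c‖ ≤ C * 2 ^ (n * i.level) * |c| := by
        rw [norm_mul, Real.norm_eq_abs, Real.norm_eq_abs]
        gcongr
        exact hξ i
    _ = C * (2 ^ (n * i.level) * |c|) := mul_assoc _ _ _
    _ ≤ C * (K * decaySeminorm (d + 1) (d + 1 + n + 1) f * i.decay) :=
        mul_le_mul_of_nonneg_left (hdecay f i) hC
    _ = C * K * decaySeminorm (d + 1) (d + 1 + n + 1) f * i.decay := by ring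

theorem WaveletBasis.exists_coeff_eq (W : WaveletBasis d) {ξ : WaveletIndex d → ℝ}
    (hξ : WaveletIndex.IsTempered ξ) : ∃ g : Distr d, ∀ i, W.coeff g i = ξ i := by
  obtain ⟨K, N, hK, hbound⟩ := hξ.exists_norm_mul_integral_le W
  set c : 𝓢(Space d, ℝ) → WaveletIndex d → ℝ := fun f i => ∫ x, f x * waveletAtom W.φ W.ψ i x
  have hsum (f : 𝓢(Space d, ℝ)) : Summable fun i => ξ i * c f i :=
    .of_norm_bounded ((WaveletIndex.summable_decay d).mul_left _) (hbound f)
  have hadd (f g : 𝓢(Space d, ℝ)) :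
      ∑' i, ξ i * c (f + g) i = ∑' i, ξ i * c f i + ∑' i, ξ i * c g i := by
    rw [← (hsum f).tsum_add (hsum g)]
    refine tsum_congr fun i => ?_
    simp only [c, add_apply, add_mul]
    rw [integral_add (W.integrable_mul_waveletAtom f i) (W.integrable_mul_waveletAtom g i), mul_add]
  have hsmul (a : ℝ) (f : 𝓢(Space d, ℝ)) : ∑' i, ξ i * c (a • f) i = a * ∑' i, ξ i * c f i := by
    rw [← tsum_mul_left]
    refine tsum_congr fun i => ?_
    simp only [c, smul_apply, smul_eq_mul, mul_assoc]
    rw [integral_const_mul, mul_left_comm]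
  have hcont (f : 𝓢(Space d, ℝ)) : ‖∑' i, ξ i * c f i‖ ≤
      K * 2 ^ (d + 1) * (∑' i : WaveletIndex d, i.decay) *
        (Finset.Iic (d + 1, N)).sup (schwartzSeminormFamily ℝ (Space d) ℝ) f := by
    refine (tsum_of_norm_bounded ((WaveletIndex.summable_decay d).hasSum.mul_left _)
      (hbound f)).trans_eq ?_
    change K * (2 ^ (d + 1) * _) * _ = _
    ring
  refine ⟨SchwartzMap.mkCLMtoNormedSpace (fun f => ∑' i, ξ i * c f i) hadd hsmul
    ⟨_, _, mul_nonneg (by positivity) (tsum_nonneg WaveletIndex.decay_nonneg), hcont⟩, fun i => ?_⟩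
  change ∑' i', ξ i' * c (waveletAtom W.φ W.ψ i) i' = ξ i
  rw [tsum_eq_single i fun i' hi => by simp [c, W.orthogonal i i' hi.symm]]
  simp [c, W.normalized i]

end Synthesis

section StrongConvexity

theorem abs_rpow_sub_two_mul_of_nonneg {p t : ℝ} (hp : 1 < p) (ht : 0 ≤ t) :
    |t| ^ (p - 2) * t = t ^ (p - 1) := by
  rcases ht.eq_or_lt with rfl | ht
  · rw [mul_zero, Real.zero_rpow (sub_ne_zero.2 hp.ne')]
  · rw [abs_of_pos ht, ← Real.rpow_add_one ht.ne', show p - 2 + 1 = p - 1 by ring]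

theorem abs_rpow_sub_two_mul_abs {p : ℝ} (hp : 1 < p) (t : ℝ) :
    |t| ^ (p - 2) * |t| = |t| ^ (p - 1) := by
  simpa only [abs_abs] using abs_rpow_sub_two_mul_of_nonneg hp (abs_nonneg t)

theorem abs_rpow_sub_two_mul_mul_self {p : ℝ} (hp : 1 < p) (t : ℝ) :
    |t| ^ (p - 2) * t * t = |t| ^ p := by
  rw [mul_assoc, ← abs_mul_abs_self, ← mul_assoc, abs_rpow_sub_two_mul_abs hp,
    ← Real.rpow_add_one' (abs_nonneg t) (by linarith), sub_add_cancel]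

theorem mul_sub_le_rpow_sub_rpow {q M s t : ℝ} (hq : 0 ≤ q) (hq1 : q ≤ 1) (hs : 0 ≤ s)
    (hst : s ≤ t) (ht : t ≤ M) : q * M ^ (q - 1) * (t - s) ≤ t ^ q - s ^ q := by
  refine Convex.mul_sub_le_image_sub_of_le_deriv (f := fun x => x ^ q) (convex_Icc 0 M)
    (Real.continuous_rpow_const hq).continuousOn ?_ ?_ s ⟨hs, hst.trans ht⟩ t
    ⟨hs.trans hst, ht⟩ hst
  · rw [interior_Icc]
    exact fun x hx => (Real.differentiableAt_rpow_const_of_ne q hx.1.ne').differentiableWithinAt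
  · rw [interior_Icc]
    intro x hx
    rw [Real.deriv_rpow_const]
    exact mul_le_mul_of_nonneg_left
      (Real.rpow_le_rpow_of_nonpos hx.1 hx.2.le (by linarith)) hq

theorem mul_sub_le_abs_rpow_mul_sub {p M s t : ℝ} (hp : 1 < p) (hp2 : p ≤ 2) (hs : -M ≤ s)
    (hst : s ≤ t) (ht : t ≤ M) :
    (p - 1) * M ^ (p - 2) * (t - s) ≤ |t| ^ (p - 2) * t - |s| ^ (p - 2) * s := by
  have hnonneg : ∀ {a b : ℝ}, 0 ≤ a → a ≤ b → b ≤ M →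
      (p - 1) * M ^ (p - 2) * (b - a) ≤ |b| ^ (p - 2) * b - |a| ^ (p - 2) * a := by
    intro a b ha hab hb
    rw [abs_rpow_sub_two_mul_of_nonneg hp ha, abs_rpow_sub_two_mul_of_nonneg hp (ha.trans hab),
      show p - 2 = p - 1 - 1 by ring]
    exact mul_sub_le_rpow_sub_rpow (by linarith) (by linarith) ha hab hb
  have hnonpos : ∀ {a b : ℝ}, -M ≤ a → a ≤ b → b ≤ 0 →
      (p - 1) * M ^ (p - 2) * (b - a) ≤ |b| ^ (p - 2) * b - |a| ^ (p - 2) * a := by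
    intro a b ha hab hb
    have hneg := hnonneg (neg_nonneg.2 hb) (neg_le_neg hab) (neg_le.1 ha)
    rw [abs_neg, abs_neg] at hneg
    linarith
  rcases le_total 0 s with h0s | hs0
  · exact hnonneg h0s hst ht
  rcases le_total t 0 with ht0 | h0t
  · exact hnonpos hs hst ht0
  · linarith [hnonneg le_rfl h0t ht, hnonpos hs hs0 le_rfl]

theorem strongConvexOn_abs_rpow {p : ℝ} (hp : 1 < p) (hp2 : p ≤ 2) (M : ℝ) :
    StrongConvexOn (Set.Icc (-M) M) (p * (p - 1) * M ^ (p - 2)) fun t => |t| ^ p := by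
  rw [strongConvexOn_iff_convex]
  set κ := (p - 1) * M ^ (p - 2) with hκ
  simp only [mul_assoc p, ← hκ, Real.norm_eq_abs, sq_abs]
  have hderiv (t : ℝ) : HasDerivAt (fun t : ℝ => |t| ^ p - p * κ / 2 * t ^ 2)
      (p * (|t| ^ (p - 2) * t - κ * t)) t := by
    refine ((hasDerivAt_abs_rpow t hp).sub
      ((hasDerivAt_pow 2 t).const_mul (p * κ / 2))).congr_deriv ?_
    push_cast
    ring
  refine MonotoneOn.convexOn_of_deriv (convex_Icc _ _)
    (fun t _ => (hderiv t).continuousAt.continuousWithinAt)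
    (fun t _ => (hderiv t).differentiableAt.differentiableWithinAt) fun s hs t ht hst => ?_
  rw [(hderiv s).deriv, (hderiv t).deriv]
  have hmono := mul_sub_le_abs_rpow_mul_sub hp hp2 (interior_subset hs).1 hst (interior_subset ht).2
  exact mul_le_mul_of_nonneg_left (by linarith) (by linarith)

theorem tangent_le_of_convexOn {s : Set ℝ} {f : ℝ → ℝ} {f' a b : ℝ} (hf : ConvexOn ℝ s f)
    (ha : a ∈ s) (hb : b ∈ s) (hf' : HasDerivAt f f' b) : f' * (a - b) ≤ f a - f b := by
  rcases lt_trichotomy a b with hab | rfl | hab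
  · have hslope := hf.slope_le_of_hasDerivAt ha hb hab hf'
    rw [slope_def_field, div_le_iff₀ (sub_pos.2 hab)] at hslope
    linarith
  · simp
  · have hslope := hf.le_slope_of_hasDerivAt hb ha hab hf'
    rwa [slope_def_field, le_div_iff₀ (sub_pos.2 hab)] at hslope

theorem tangent_add_sq_le_of_strongConvexOn {s : Set ℝ} {f : ℝ → ℝ} {m f' a b : ℝ}
    (hf : StrongConvexOn s m f) (ha : a ∈ s) (hb : b ∈ s) (hf' : HasDerivAt f f' b) :
    m / 2 * (a - b) ^ 2 ≤ f a - f b - f' * (a - b) := by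
  have hderiv : HasDerivAt (fun t => f t - m / 2 * ‖t‖ ^ 2) (f' - m * b) b := by
    simp only [Real.norm_eq_abs, sq_abs]
    refine (hf'.sub ((hasDerivAt_pow 2 b).const_mul (m / 2))).congr_deriv ?_
    push_cast
    ring
  have htangent := tangent_le_of_convexOn (strongConvexOn_iff_convex.1 hf) ha hb hderiv
  simp only [Real.norm_eq_abs, sq_abs] at htangent
  linarith

end StrongConvexity

section Sequences

variable {ι : Type*}

theorem summable_of_tsum_ofReal_ne_top {f : ι → ℝ} (hf : ∀ i, 0 ≤ f i)
    (h : ∑' i, ENNReal.ofReal (f i) ≠ ⊤) : Summable f := by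
  simpa only [ENNReal.toReal_ofReal (hf _)] using ENNReal.summable_toReal h

theorem abs_le_tsum_abs_rpow_inv {x : ι → ℝ} {p : ℝ} (hp : 0 < p)
    (hx : Summable fun i => |x i| ^ p) (i : ι) : |x i| ≤ (∑' i, |x i| ^ p) ^ p⁻¹ := by
  rw [Real.le_rpow_inv_iff_of_pos (abs_nonneg _) (tsum_nonneg fun i => by positivity) hp]
  exact hx.le_tsum i fun j _ => by positivity

theorem summable_abs_rpow_of_le {x : ι → ℝ} {q p : ℝ} (hq : 0 < q) (hqp : q ≤ p)
    (hx : Summable fun i => |x i| ^ q) : Summable fun i => |x i| ^ p := by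
  have toReal_ofReal {r : ℝ} (hr : 0 < r) : (ENNReal.ofReal r).toReal = r :=
    ENNReal.toReal_ofReal hr.le
  have hp := hq.trans_le hqp
  have hmem : Memℓp x (ENNReal.ofReal q) := by
    rw [memℓp_gen_iff (by rwa [toReal_ofReal hq]), toReal_ofReal hq]
    exact hx
  have hmem' := hmem.of_exponent_ge (ENNReal.ofReal_le_ofReal hqp)
  rw [memℓp_gen_iff (by rwa [toReal_ofReal hp]), toReal_ofReal hp] at hmem'
  exact hmem'

variable {p : ℝ} {x x₀ : ι → ℝ}

-- The Bregman distance of `Σ |x_i| ^ p` dominates the squared `ℓ²` distance, because the entries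
-- of `x` and `x₀` are bounded by `B ^ (1/p)`.
theorem summable_sq_sub_and_mul_tsum_le (hp : 1 < p) (hp2 : p ≤ 2)
    (hx : Summable fun i => |x i| ^ p) (hx₀ : Summable fun i => |x₀ i| ^ p) {B m : ℝ}
    (hxB : ∑' i, |x i| ^ p ≤ B) (hx₀B : ∑' i, |x₀ i| ^ p ≤ B) (hB : 0 < B)
    (hm : HasSum (fun i => p * |x₀ i| ^ (p - 2) * x₀ i * (x i - x₀ i)) m) :
    (Summable fun i => (x i - x₀ i) ^ 2) ∧
      p * (p - 1) * (B ^ p⁻¹) ^ (p - 2) / 2 * ∑' i, (x i - x₀ i) ^ 2 ≤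
        ∑' i, |x i| ^ p - ∑' i, |x₀ i| ^ p - m := by
  have hp0 : 0 < p := zero_lt_one.trans hp
  have hbound {z : ι → ℝ} (hz : Summable fun i => |z i| ^ p) (hzB : ∑' i, |z i| ^ p ≤ B) (i : ι) :
      z i ∈ Set.Icc (-B ^ p⁻¹) (B ^ p⁻¹) :=
    abs_le.1 ((abs_le_tsum_abs_rpow_inv hp0 hz i).trans (by gcongr))
  set κ := p * (p - 1) * (B ^ p⁻¹) ^ (p - 2) / 2
  have hκ : 0 < κ := by
    have : 0 < p - 1 := sub_pos.2 hp
    positivity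
  have hle (i : ι) : κ * (x i - x₀ i) ^ 2 ≤
      |x i| ^ p - |x₀ i| ^ p - p * |x₀ i| ^ (p - 2) * x₀ i * (x i - x₀ i) :=
    tangent_add_sq_le_of_strongConvexOn (strongConvexOn_abs_rpow hp hp2 (B ^ p⁻¹))
      (hbound hx hxB i) (hbound hx₀ hx₀B i) (hasDerivAt_abs_rpow (x₀ i) hp)
  have hbregman := (hx.hasSum.sub hx₀.hasSum).sub hm
  have hsum : Summable fun i => (x i - x₀ i) ^ 2 :=
    (summable_mul_left_iff hκ.ne').1
      (.of_nonneg_of_le (fun i => by positivity) hle hbregman.summable)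
  refine ⟨hsum, ?_⟩
  rw [← tsum_mul_left, ← hbregman.tsum_eq]
  exact (hsum.mul_left κ).tsum_le_tsum hle hbregman.summable

end Sequences

section BesovSpace

variable {d : ℕ} (W : WaveletBasis d)

/-- The weighted wavelet coefficient `2 ^ (τ |λ|) u_λ`: for `τ = s + d (1/2 - 1/p)`, the `ℓ^p` norm
of these coefficients is the norm of `B^s_p`. -/
def WaveletBasis.weightedCoeff (τ : ℝ) (u : Distr d) (i : WaveletIndex d) : ℝ :=
  (2 : ℝ) ^ (τ * i.level) * W.coeff u i

theorem WaveletBasis.weightedCoeff_sub (τ : ℝ) (u v : Distr d) (i : WaveletIndex d) :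
    W.weightedCoeff τ (u - v) i = W.weightedCoeff τ u i - W.weightedCoeff τ v i :=
  mul_sub ((2 : ℝ) ^ (τ * i.level)) (W.coeff u i) (W.coeff v i)

theorem two_rpow_mul_abs_rpow (p τ l c : ℝ) :
    (2 : ℝ) ^ (p * τ * l) * |c| ^ p = |(2 : ℝ) ^ (τ * l) * c| ^ p := by
  have hpos : (0 : ℝ) < 2 ^ (τ * l) := by positivity
  rw [abs_mul, abs_of_pos hpos, Real.mul_rpow hpos.le (abs_nonneg c),
    ← Real.rpow_mul two_pos.le, mul_assoc, mul_comm p]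

theorem besovNorm_eq_tsum_weightedCoeff (s p : ℝ) (u : Distr d) :
    besovNorm W s p u =
      (∑' i, ENNReal.ofReal (|W.weightedCoeff (rateExponent d s p) u i| ^ p)) ^ (1 / p) := by
  simp only [besovNorm, two_rpow_mul_abs_rpow, WaveletBasis.weightedCoeff, rateExponent]

theorem besovNorm_rpow_eq_tsum_weightedCoeff (s : ℝ) {p : ℝ} (hp : 0 < p) (u : Distr d) :
    besovNorm W s p u ^ p =
      ∑' i, ENNReal.ofReal (|W.weightedCoeff (rateExponent d s p) u i| ^ p) := by
  rw [besovNorm_eq_tsum_weightedCoeff, ← ENNReal.rpow_mul, one_div, inv_mul_cancel₀ hp.ne',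
    ENNReal.rpow_one]

theorem besovNorm_two_eq_ofReal_sqrt {τ : ℝ} {u : Distr d}
    (hu : Summable fun i => W.weightedCoeff τ u i ^ 2) :
    besovNorm W τ 2 u = ENNReal.ofReal √(∑' i, W.weightedCoeff τ u i ^ 2) := by
  have hτ : rateExponent d τ 2 = τ := by simp [rateExponent]
  simp only [besovNorm_eq_tsum_weightedCoeff, hτ, Real.rpow_two, sq_abs]
  rw [← ENNReal.ofReal_tsum_of_nonneg (fun i => sq_nonneg _) hu,
    ENNReal.ofReal_rpow_of_nonneg (tsum_nonneg fun i => sq_nonneg _) one_half_pos.le,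
    Real.sqrt_eq_rpow]

theorem besovNorm_two_mono {σ τ : ℝ} (h : σ ≤ τ) (u : Distr d) :
    besovNorm W σ 2 u ≤ besovNorm W τ 2 u := by
  refine ENNReal.rpow_le_rpow (ENNReal.tsum_le_tsum fun i => ENNReal.ofReal_le_ofReal ?_)
    (by norm_num)
  gcongr
  exact one_le_two

theorem mem_besovSpace_iff_summable (s p : ℝ) (hp : 0 < p) (u : Distr d) :
    u ∈ besovSpace W s p hp ↔
      Summable fun i => |W.weightedCoeff (rateExponent d s p) u i| ^ p := by
  change besovNorm W s p u < ⊤ ↔ _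
  rw [besovNorm_eq_tsum_weightedCoeff, ENNReal.rpow_lt_top_iff_of_pos (one_div_pos.2 hp)]
  exact ⟨fun h => summable_of_tsum_ofReal_ne_top (fun i => by positivity) h.ne,
    fun h => h.tsum_ofReal_lt_top⟩

theorem WaveletIndex.isTempered_of_summable {τ p : ℝ} (hp : 0 < p) {ξ : WaveletIndex d → ℝ}
    (hξ : Summable fun i => |(2 : ℝ) ^ (τ * i.level) * ξ i| ^ p) : WaveletIndex.IsTempered ξ := by
  refine ⟨(∑' i, |(2 : ℝ) ^ (τ * i.level) * ξ i| ^ p) ^ p⁻¹, ⌈-τ⌉₊, fun i => ?_⟩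
  have hweight : (2 : ℝ) ^ (-τ * i.level) ≤ 2 ^ (⌈-τ⌉₊ * i.level) := by
    rw [← Real.rpow_natCast, Nat.cast_mul]
    exact Real.rpow_le_rpow_of_exponent_le one_le_two (by gcongr; exact Nat.le_ceil _)
  calc |ξ i| = |(2 : ℝ) ^ (τ * i.level) * ξ i| * 2 ^ (-τ * i.level) := by
        rw [abs_mul, abs_of_pos (by positivity : (0 : ℝ) < 2 ^ (τ * i.level)), mul_right_comm,
          ← Real.rpow_add two_pos, neg_mul, add_neg_cancel, Real.rpow_zero, one_mul]
    _ ≤ _ := by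
        gcongr
        exact abs_le_tsum_abs_rpow_inv hp hξ i

theorem exists_mem_besovSpace_coeff_eq (s p : ℝ) (hp : 0 < p) {ξ : WaveletIndex d → ℝ}
    (hξ : Summable fun i => |(2 : ℝ) ^ (rateExponent d s p * i.level) * ξ i| ^ p) :
    ∃ g ∈ besovSpace W s p hp, ∀ i, W.coeff g i = ξ i := by
  obtain ⟨g, hg⟩ := W.exists_coeff_eq (WaveletIndex.isTempered_of_summable hp hξ)
  refine ⟨g, (mem_besovSpace_iff_summable W s p hp g).2 ?_, hg⟩
  simpa only [WaveletBasis.weightedCoeff, hg] using hξ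

/-- The wavelet coefficients of the derivative at `u` of the penalty `∑_λ |2 ^ (τ |λ|) u_λ| ^ p`. -/
def WaveletBasis.penaltyGradient (τ p : ℝ) (u : Distr d) (i : WaveletIndex d) : ℝ :=
  (2 : ℝ) ^ (τ * i.level) *
    (p * |W.weightedCoeff τ u i| ^ (p - 2) * W.weightedCoeff τ u i)

theorem WaveletBasis.penaltyGradient_mul_coeff (τ p : ℝ) (u v : Distr d) (i : WaveletIndex d) :
    W.penaltyGradient τ p u i * W.coeff v i =
      p * |W.weightedCoeff τ u i| ^ (p - 2) * W.weightedCoeff τ u i * W.weightedCoeff τ v i := by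
  rw [penaltyGradient, weightedCoeff, weightedCoeff]
  ring

theorem WaveletBasis.abs_penaltyGradient (τ : ℝ) {p : ℝ} (hp : 1 < p) (u : Distr d)
    (i : WaveletIndex d) :
    |W.penaltyGradient τ p u i| = (2 : ℝ) ^ (τ * i.level) *
      (p * |W.weightedCoeff τ u i| ^ (p - 1)) := by
  rw [penaltyGradient, abs_mul, abs_mul, ← abs_rpow_sub_two_mul_abs hp,
    abs_of_nonneg (by positivity : (0 : ℝ) ≤ 2 ^ (τ * i.level)),
    abs_of_nonneg (by positivity : 0 ≤ p * |W.weightedCoeff τ u i| ^ (p - 2)), mul_assoc p]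

end BesovSpace

section Tikhonov

-- The bound on the Bregman distance of the penalty at `v₀` towards the minimizer, from the source
-- condition `∂R(v₀) ∋ F* w`; the mixed term is absorbed into the data misfit.
theorem bregman_le {E : Type*} [NormedAddCommGroup E] [InnerProductSpace ℝ E] (w v v₀ y : E)
    {a b α δ R R₀ : ℝ} (ha : 0 < a) (hδ : 0 < δ) (hα : a * δ ≤ α) (hα' : α ≤ b * δ)
    (hy : ‖v₀ - y‖ ≤ δ) (hmin : ‖v - y‖ ^ 2 + α * R ≤ ‖v₀ - y‖ ^ 2 + α * R₀) :
    R - R₀ - inner ℝ w (v - v₀) ≤ (1 / a + ‖w‖ + b * ‖w‖ ^ 2) * δ := by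
  have hα0 : 0 < α := (mul_pos ha hδ).trans_le hα
  have hinner : -inner ℝ w (v - v₀) ≤ ‖w‖ * (‖v - y‖ + δ) := by
    calc -inner ℝ w (v - v₀) ≤ ‖w‖ * ‖v - v₀‖ :=
          (neg_le_abs _).trans (abs_real_inner_le_norm _ _)
      _ = ‖w‖ * ‖(v - y) - (v₀ - y)‖ := by rw [sub_sub_sub_cancel_right]
      _ ≤ ‖w‖ * (‖v - y‖ + ‖v₀ - y‖) := by gcongr; exact norm_sub_le _ _
      _ ≤ ‖w‖ * (‖v - y‖ + δ) := by gcongr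
  have hmisfit : ‖v₀ - y‖ ^ 2 ≤ δ ^ 2 := by gcongr
  have hδα : δ ≤ α / a := (le_div_iff₀' ha).2 hα
  refine le_of_mul_le_mul_left ?_ hα0
  calc α * (R - R₀ - inner ℝ w (v - v₀))
      ≤ α * (R - R₀) + α * (‖w‖ * (‖v - y‖ + δ)) := by
        rw [sub_eq_add_neg, mul_add]
        gcongr
    _ ≤ δ * δ + α * ‖w‖ * δ + α * α * ‖w‖ ^ 2 := by
        nlinarith [sq_nonneg (‖v - y‖ - α * ‖w‖ / 2), sq_nonneg (α * ‖w‖)]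
    _ ≤ δ * (α / a) + α * ‖w‖ * δ + α * (b * δ) * ‖w‖ ^ 2 := by gcongr
    _ = α * ((1 / a + ‖w‖ + b * ‖w‖ ^ 2) * δ) := by ring

theorem penalty_le_of_tikhonov_le {a α δ m m₀ R R₀ : ℝ} (ha : 0 < a) (hδ : 0 < δ) (hδ1 : δ ≤ 1)
    (hα : a * δ ≤ α) (hm₀ : 0 ≤ m₀) (hm₀δ : m₀ ≤ δ)
    (hmin : m ^ 2 + α * R ≤ m₀ ^ 2 + α * R₀) : R ≤ R₀ + 1 / a := by
  have hα0 : 0 < α := (mul_pos ha hδ).trans_le hα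
  refine le_of_mul_le_mul_left ?_ hα0
  have hmisfit : m₀ ^ 2 ≤ α * (1 / a) := by
    calc m₀ ^ 2 ≤ δ ^ 2 := by gcongr
      _ ≤ δ := pow_le_of_le_one hδ.le hδ1 two_ne_zero
      _ ≤ α * (1 / a) := by rwa [mul_one_div, le_div_iff₀' ha]
  linarith [sq_nonneg m]

variable {d : ℕ} {W : WaveletBasis d} {sD pD : ℝ} {hD : 0 < pD}
  {F : besovSpace W sD pD hD →ₗ[ℝ] L2 d} {u uDag : besovSpace W sD pD hD} {s p α : ℝ} {y : L2 d}

theorem tikhonov_eq_ofReal (hp : 0 < p) (hα : 0 ≤ α)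
    (hu : Summable fun i => |W.weightedCoeff (rateExponent d s p) u i| ^ p) :
    tikhonov F s p α y u = ENNReal.ofReal
      (‖F u - y‖ ^ 2 + α * ∑' i, |W.weightedCoeff (rateExponent d s p) u i| ^ p) := by
  have hpenalty : 0 ≤ ∑' i, |W.weightedCoeff (rateExponent d s p) u i| ^ p :=
    tsum_nonneg fun i => by positivity
  rw [tikhonov, besovNorm_rpow_eq_tsum_weightedCoeff W s hp,
    ← ENNReal.ofReal_tsum_of_nonneg (fun i => by positivity) hu, ← ENNReal.ofReal_mul hα,
    ← ENNReal.ofReal_add (sq_nonneg _) (mul_nonneg hα hpenalty)]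

theorem IsTikhonovMinimizer.summable (hu : IsTikhonovMinimizer F s p α y u) (hp : 0 < p)
    (hα : 0 < α) (hDag : Summable fun i => |W.weightedCoeff (rateExponent d s p) uDag i| ^ p) :
    Summable fun i => |W.weightedCoeff (rateExponent d s p) u i| ^ p := by
  refine summable_of_tsum_ofReal_ne_top (fun i => by positivity) fun htop => ?_
  have hmin := hu uDag
  rw [tikhonov_eq_ofReal hp hα.le hDag, tikhonov, besovNorm_rpow_eq_tsum_weightedCoeff W s hp,
    htop, ENNReal.mul_top (ENNReal.ofReal_pos.2 hα).ne', add_top] at hmin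
  exact ENNReal.ofReal_ne_top (top_le_iff.1 hmin)

theorem IsTikhonovMinimizer.misfit_add_penalty_le (hu : IsTikhonovMinimizer F s p α y u)
    (hp : 0 < p) (hα : 0 < α)
    (hDag : Summable fun i => |W.weightedCoeff (rateExponent d s p) uDag i| ^ p) :
    ‖F u - y‖ ^ 2 + α * ∑' i, |W.weightedCoeff (rateExponent d s p) u i| ^ p ≤
      ‖F uDag - y‖ ^ 2 + α * ∑' i, |W.weightedCoeff (rateExponent d s p) uDag i| ^ p := by
  have hmin := hu uDag
  rwa [tikhonov_eq_ofReal hp hα.le (hu.summable hp hα hDag), tikhonov_eq_ofReal hp hα.le hDag,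
    ENNReal.ofReal_le_ofReal_iff] at hmin
  exact add_nonneg (sq_nonneg _) (mul_nonneg hα.le (tsum_nonneg fun i => by positivity))

theorem summable_of_summable_penaltyGradient_mul {τ : ℝ} {v : Distr d} (hp : 1 < p)
    (hv : Summable fun i => W.penaltyGradient τ p v i * W.coeff v i) :
    Summable fun i => |W.weightedCoeff τ v i| ^ p := by
  refine (summable_mul_left_iff (zero_lt_one.trans hp).ne').1 (hv.congr fun i => ?_)
  rw [W.penaltyGradient_mul_coeff, mul_assoc p, mul_assoc p, abs_rpow_sub_two_mul_mul_self hp]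

theorem IsTikhonovMinimizer.besovNorm_sub_le {a b δ : ℝ} {w : L2 d}
    (hu : IsTikhonovMinimizer F s p α y u) (hp : 1 < p) (hp2 : p ≤ 2)
    (hw : ∀ v : besovSpace W sD pD hD, HasSum (fun i =>
      W.penaltyGradient (rateExponent d s p) p uDag i * W.coeff (v : Distr d) i)
        (inner ℝ w (F v)))
    (ha : 0 < a) (hδ : 0 < δ) (hδ1 : δ ≤ 1) (hα : a * δ ≤ α) (hα' : α ≤ b * δ)
    (hy : ‖F uDag - y‖ ≤ δ) {B : ℝ}
    (hB : ∑' i, |W.weightedCoeff (rateExponent d s p) uDag i| ^ p + 1 / a ≤ B) :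
    besovNorm W (rateExponent d s p) 2 ((u : Distr d) - uDag) ≤
      ENNReal.ofReal √((1 / a + ‖w‖ + b * ‖w‖ ^ 2) * δ /
        (p * (p - 1) * (B ^ p⁻¹) ^ (p - 2) / 2)) := by
  set τ := rateExponent d s p
  have hp0 : 0 < p := zero_lt_one.trans hp
  have : 0 < p - 1 := sub_pos.2 hp
  have hα0 : 0 < α := (mul_pos ha hδ).trans_le hα
  have hDag := summable_of_summable_penaltyGradient_mul hp (hw uDag).summable
  have hpenalty : Summable fun i => |W.weightedCoeff τ u i| ^ p := hu.summable hp0 hα0 hDag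
  have hR₀ : 0 ≤ ∑' i, |W.weightedCoeff τ uDag i| ^ p := tsum_nonneg fun i => by positivity
  have ha' : 0 < 1 / a := one_div_pos.2 ha
  have hmin := hu.misfit_add_penalty_le hp0 hα0 hDag
  have hB0 : 0 < B := by linarith
  have huB := penalty_le_of_tikhonov_le ha hδ hδ1 hα (norm_nonneg _) hy hmin
  have hsource : HasSum (fun i => p * |W.weightedCoeff τ uDag i| ^ (p - 2) *
      W.weightedCoeff τ uDag i * (W.weightedCoeff τ u i - W.weightedCoeff τ uDag i))
      (inner ℝ w (F u - F uDag)) := by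
    simpa only [W.penaltyGradient_mul_coeff, ← mul_sub, ← inner_sub_right]
      using (hw u).sub (hw uDag)
  obtain ⟨hsum, hle⟩ := summable_sq_sub_and_mul_tsum_le hp hp2 hpenalty hDag (huB.trans hB)
    (by linarith) hB0 hsource
  simp only [← W.weightedCoeff_sub] at hsum hle
  rw [besovNorm_two_eq_ofReal_sqrt W hsum]
  refine ENNReal.ofReal_le_ofReal (Real.sqrt_le_sqrt ((le_div_iff₀' (by positivity)).2 ?_))
  exact hle.trans (bregman_le w _ _ y ha hδ hα hα' hy hmin)

theorem convergenceRate_of_penaltyGradient_mem_adjointRange {g : Distr d} (hp : 1 < p)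
    (hp2 : p ≤ 2) (hg : g ∈ adjointRange F)
    (hgc : ∀ i, W.coeff g i = W.penaltyGradient (rateExponent d s p) p uDag i) :
    ConvergenceRate F uDag s p (rateExponent d s p) := by
  obtain ⟨w, hw⟩ := hg
  simp only [hgc] at hw
  intro a b ha hb
  set B := ∑' i, |W.weightedCoeff (rateExponent d s p) uDag i| ^ p + 1 / a
  have : 0 < B :=
    add_pos_of_nonneg_of_pos (tsum_nonneg fun i => by positivity) (one_div_pos.2 ha)
  have : 0 < p - 1 := sub_pos.2 hp
  refine ⟨√((1 / a + ‖w‖ + b * ‖w‖ ^ 2) / (p * (p - 1) * (B ^ p⁻¹) ^ (p - 2) / 2)), 1,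
    by positivity, one_pos, fun δ hδ hδ1 α hα hα' y hy u hu => ?_⟩
  rw [← Real.sqrt_mul (by positivity), div_mul_eq_mul_div]
  exact hu.besovNorm_sub_le hp hp2 hw ha hδ hδ1.le hα hα' hy le_rfl

end Tikhonov

section Indices

variable {d : ℕ} {sS pS pD sG pG ε p q sR pR : ℝ}

-- The weights of the norms of `B_S`, `B_G` and `B_R` are `2 ^ (τ |λ|)` with `τ` the rate exponents,
-- and in these the index condition is linear.
theorem rateExponent_smoothnessBound (hpG : 0 < pG) (hp : 0 < p) :
    rateExponent d (smoothnessBound d sS pS sG pG ε p) ((p + pG) / pG) =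
      (p * rateExponent d sS pS - pG * rateExponent d sG pG) / (p + pG) - ε * (p / pS - 1) := by
  simp only [rateExponent, smoothnessBound, one_div_div]
  field_simp
  ring

theorem rateExponent_le_iff {s t : ℝ} : rateExponent d s p ≤ rateExponent d t p ↔ s ≤ t :=
  add_le_add_iff_right _

theorem mul_rateExponent_le_of_le_smoothnessBound (hpS : 0 < pS) (hpG : 0 < pG) (hε : 0 ≤ ε)
    (hSp : pS ≤ p) (hsR : sR ≤ smoothnessBound d sS pS sG pG ε p) :
    (p + pG) * rateExponent d sR ((p + pG) / pG) ≤
      p * rateExponent d sS pS - pG * rateExponent d sG pG := by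
  have hp : 0 < p := hpS.trans_le hSp
  have hle := rateExponent_le_iff (d := d) (p := (p + pG) / pG).2 hsR
  rw [rateExponent_smoothnessBound hpG hp] at hle
  have hloss : 0 ≤ ε * (p / pS - 1) := mul_nonneg hε (sub_nonneg.2 ((one_le_div hpS).2 hSp))
  exact (le_div_iff₀' (by positivity)).1 (hle.trans (sub_le_self _ hloss))

theorem rateExponent_smoothnessBound_lt (hpS : 0 < pS) (hpG : 0 < pG) (hp : 0 < p) (hpq : p < q)
    (hq : q ≤ pG) (hpos : 0 < rateExponent d sS pS + rateExponent d sG pG)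
    (hε : ε < pS * (rateExponent d sS pS + rateExponent d sG pG) / (4 * pG)) :
    rateExponent d (smoothnessBound d sS pS sG pG ε p) ((p + pG) / pG) <
      rateExponent d (smoothnessBound d sS pS sG pG ε q) ((q + pG) / pG) := by
  have hq0 : 0 < q := hp.trans hpq
  rw [rateExponent_smoothnessBound hpG hp, rateExponent_smoothnessBound hpG hq0]
  set ρ := rateExponent d sS pS
  set γ := rateExponent d sG pG
  have hdiff : ((q * ρ - pG * γ) / (q + pG) - ε * (q / pS - 1)) -
      ((p * ρ - pG * γ) / (p + pG) - ε * (p / pS - 1)) =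
      (q - p) * (pG * (ρ + γ) / ((p + pG) * (q + pG)) - ε / pS) := by
    field_simp
    ring
  have hloss : ε / pS < pG * (ρ + γ) / ((p + pG) * (q + pG)) := by
    calc ε / pS < pG * (ρ + γ) / ((2 * pG) * (2 * pG)) := by
          rw [div_lt_iff₀ hpS]
          refine hε.trans_eq ?_
          field_simp
          ring
      _ ≤ pG * (ρ + γ) / ((p + pG) * (q + pG)) := by gcongr <;> linarith
  rw [← sub_pos, hdiff]
  exact mul_pos (sub_pos.2 hpq) (sub_pos.2 hloss)

theorem allowedPenalty_opt (hpD : 0 < pD) (hpG : 0 < pG) (hSD : pS ≤ pD) (hSG : pS ≤ pG) :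
    AllowedPenalty d sS pS pD sG pG ε (optS d sS pS pD sG pG ε) (optP pD pG) :=
  ⟨min pD pG, lt_min hpD hpG, le_min hSD hSG, le_rfl, rfl, le_rfl⟩

theorem div_conjExponent_eq_sub_div {x : ℝ} (hp : 1 < p) : x / p.conjExponent = x - x / p := by
  have hp1 : p - 1 ≠ 0 := (sub_pos.2 hp).ne'
  rw [Real.conjExponent]
  field_simp

theorem rateExponent_add_rateExponent_pos {sD : ℝ} (hpD : 1 < pD)
    (hSD : sD - d / pD < sS - d / pS) (hGD : -sD - d / pD.conjExponent ≤ sG - d / pG) :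
    0 < rateExponent d sS pS + rateExponent d sG pG := by
  rw [div_conjExponent_eq_sub_div hpD] at hGD
  simp only [rateExponent, mul_sub, mul_one_div]
  linarith

theorem AllowedPenalty.eq_opt_or_rateExponent_lt (h : AllowedPenalty d sS pS pD sG pG ε sR pR)
    (hpS : 0 < pS) (hpG : 0 < pG) (hpos : 0 < rateExponent d sS pS + rateExponent d sG pG)
    (hε : ε < pS * (rateExponent d sS pS + rateExponent d sG pG) / (4 * pG)) :
    (sR = optS d sS pS pD sG pG ε ∧ pR = optP pD pG) ∨
      rateExponent d sR pR < optRate d pD sG pG ε sS pS := by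
  obtain ⟨p, hp, -, hpmin, rfl, hsR⟩ := h
  rcases hpmin.eq_or_lt with rfl | hlt
  · rcases hsR.eq_or_lt with rfl | hlt
    · exact .inl ⟨rfl, rfl⟩
    · exact .inr (add_lt_add_left hlt _)
  · exact .inr ((rateExponent_le_iff.2 hsR).trans_lt
      (rateExponent_smoothnessBound_lt hpS hpG hp hlt (min_le_right _ _) hpos hε))

theorem AllowedPenalty.rateExponent_le_optRate (h : AllowedPenalty d sS pS pD sG pG ε sR pR)
    (hpS : 0 < pS) (hpG : 0 < pG) (hpos : 0 < rateExponent d sS pS + rateExponent d sG pG)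
    (hε : ε < pS * (rateExponent d sS pS + rateExponent d sG pG) / (4 * pG)) :
    rateExponent d sR pR ≤ optRate d pD sG pG ε sS pS := by
  rcases h.eq_opt_or_rateExponent_lt hpS hpG hpos hε with ⟨rfl, rfl⟩ | hlt
  · exact le_rfl
  · exact hlt.le

theorem optP_of_le (h : pD ≤ pG) : optP pD pG = (pD + pG) / pG := by rw [optP, min_eq_left h]

theorem optP_of_ge (hpG : 0 < pG) (h : pG ≤ pD) : optP pD pG = 2 := by
  rw [optP, min_eq_right h, ← two_mul, mul_div_cancel_right₀ _ hpG.ne']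

theorem optS_of_le (h : pD ≤ pG) :
    optS d sS pS pD sG pG ε = (pD * sS - pG * sG) / (pD + pG) -
      d * (1 / (pD + pG) * (pD / pS - 1)) - ε * (pD / pS - 1) := by
  rw [optS, min_eq_left h, smoothnessBound]

theorem optS_of_ge (hpG : 0 < pG) (h : pG ≤ pD) :
    optS d sS pS pD sG pG ε =
      1 / 2 * (sS - d / pS - (sG - d / pG)) - ε * (pG / pS - 1) := by
  rw [optS, min_eq_right h, smoothnessBound]
  field_simp
  ring

theorem optRate_eq (hpD : 0 < pD) (hpG : 0 < pG) :
    optRate d pD sG pG ε sS pS =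
      (min pD pG * rateExponent d sS pS - pG * rateExponent d sG pG) / (min pD pG + pG) -
        ε * (min pD pG / pS - 1) :=
  rateExponent_smoothnessBound hpG (lt_min hpD hpG)

theorem optRate_of_le (hpD : 0 < pD) (hpG : 0 < pG) (h : pD ≤ pG) :
    optRate d pD sG pG ε sS pS = (pD * sS - pG * sG) / (pD + pG) +
      d * (1 / 2 - 1 / (pD + pG) * (pG / pG.conjExponent + pD / pS)) - ε * (pD / pS - 1) := by
  rw [optRate_eq hpD hpG, min_eq_left h, Real.conjExponent,
    div_div_cancel₀ hpG.ne', rateExponent, rateExponent]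
  field_simp
  ring

theorem optRate_of_ge (hpG : 0 < pG) (h : pG ≤ pD) :
    optRate d pD sG pG ε sS pS = optS d sS pS pD sG pG ε := by
  simp [optRate, optP_of_ge hpG h, rateExponent]

variable {sT pT : ℝ}

theorem optRate_zero_sub (hpD : 0 < pD) (hpG : 0 < pG) :
    optRate d pD sG pG 0 sT pT - optRate d pD sG pG 0 sS pS =
      min pD pG / (min pD pG + pG) * (sT - d / pT - (sS - d / pS)) := by
  simp only [optRate_eq hpD hpG, rateExponent]
  ring

theorem optRate_zero_lt (hpD : 0 < pD) (hpG : 0 < pG) (hST : sS - d / pS < sT - d / pT) :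
    optRate d pD sG pG 0 sS pS < optRate d pD sG pG 0 sT pT := by
  have : 0 < min pD pG := lt_min hpD hpG
  rw [← sub_pos, optRate_zero_sub hpD hpG]
  exact mul_pos (by positivity) (sub_pos.2 hST)

theorem continuous_optRate (hpD : 0 < pD) (hpG : 0 < pG) :
    Continuous fun ε => optRate d pD sG pG ε sS pS := by
  simp only [optRate_eq hpD hpG]
  fun_prop

theorem exists_forall_optRate_lt (hpD : 0 < pD) (hpG : 0 < pG)
    (h : optRate d pD sG pG 0 sS pS < optRate d pD sG pG 0 sT pT) :
    ∃ ε₁ : ℝ, 0 < ε₁ ∧ ∀ ε : ℝ, 0 < ε → ε < ε₁ →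
      optRate d pD sG pG ε sS pS < optRate d pD sG pG ε sT pT := by
  have hnear : ∀ᶠ ε in nhdsWithin 0 (Set.Ioi 0),
      optRate d pD sG pG ε sS pS < optRate d pD sG pG ε sT pT :=
    nhdsWithin_le_nhds ((continuous_optRate hpD hpG).continuousAt.eventually_lt
      (continuous_optRate hpD hpG).continuousAt h)
  obtain ⟨ε₁, hε₁, hlt⟩ := mem_nhdsGT_iff_exists_Ioo_subset.1 hnear
  exact ⟨ε₁, hε₁, fun ε h0 h1 => hlt ⟨h0, h1⟩⟩

end Indices

section Rate

variable {d : ℕ} {W : WaveletBasis d} {sD pD : ℝ} {hD : 0 < pD} {sS pS sG pG ε p sR τ γ ρ : ℝ}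

theorem abs_two_rpow_mul_penaltyGradient_rpow_le (u : Distr d) (hpG : 0 < pG) (hp : 0 < p)
    (hτ : (p + pG) * τ ≤ p * ρ - pG * γ) (i : WaveletIndex d) :
    |(2 : ℝ) ^ (γ * i.level) * W.penaltyGradient τ ((p + pG) / pG) u i| ^ pG ≤
      ((p + pG) / pG) ^ pG * |W.weightedCoeff ρ u i| ^ p := by
  set pR := (p + pG) / pG with hpR
  have hpR1 : 1 < pR := (one_lt_div hpG).2 (lt_add_of_pos_left pG hp)
  have hpRG : (pR - 1) * pG = p := by rw [hpR]; field_simp; ring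
  have hgradient : |W.penaltyGradient τ pR u i| ^ pG =
      pR ^ pG * (2 ^ (pG * τ * i.level) *
        (2 ^ (p * τ * i.level) * |W.coeff u i| ^ p)) := by
    rw [W.abs_penaltyGradient τ hpR1, Real.mul_rpow (by positivity) (by positivity),
      Real.mul_rpow (by positivity) (by positivity), ← Real.rpow_mul (abs_nonneg _), hpRG,
      WaveletBasis.weightedCoeff, ← two_rpow_mul_abs_rpow, ← Real.rpow_mul two_pos.le]
    ring_nf
  rw [← two_rpow_mul_abs_rpow, hgradient, WaveletBasis.weightedCoeff, ← two_rpow_mul_abs_rpow]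
  calc _ = pR ^ pG * ((2 : ℝ) ^ ((pG * γ + (p + pG) * τ) * i.level) * |W.coeff u i| ^ p) := by
        rw [show (pG * γ + (p + pG) * τ) * (i.level : ℝ) =
          pG * γ * i.level + pG * τ * i.level + p * τ * i.level by ring,
          Real.rpow_add two_pos, Real.rpow_add two_pos]
        ring
    _ ≤ pR ^ pG * ((2 : ℝ) ^ (p * ρ * i.level) * |W.coeff u i| ^ p) := by
        gcongr
        · exact one_le_two
        · linarith

theorem exists_mem_besovSpace_coeff_eq_penaltyGradient {u : Distr d} (hpS : 0 < pS)
    (hpG : 0 < pG) (hε : 0 ≤ ε) (hSp : pS ≤ p) (hsR : sR ≤ smoothnessBound d sS pS sG pG ε p)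
    (hu : u ∈ besovSpace W sS pS hpS) :
    ∃ g ∈ besovSpace W sG pG hpG, ∀ i, W.coeff g i =
      W.penaltyGradient (rateExponent d sR ((p + pG) / pG)) ((p + pG) / pG) u i := by
  have hsource := summable_abs_rpow_of_le hpS hSp ((mem_besovSpace_iff_summable W _ _ _ u).1 hu)
  refine exists_mem_besovSpace_coeff_eq W sG pG hpG ?_
  exact .of_nonneg_of_le (fun i => by positivity)
    (abs_two_rpow_mul_penaltyGradient_rpow_le u hpG (hpS.trans_le hSp)
      (mul_rateExponent_le_of_le_smoothnessBound hpS hpG hε hSp hsR))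
    (hsource.mul_left _)

theorem convergenceRate_of_mem_besovSpace {F : besovSpace W sD pD hD →ₗ[ℝ] L2 d} {hpS : 0 < pS}
    {hpG : 0 < pG} (hε : 0 ≤ ε)
    (hFG : (besovSpace W sG pG hpG : Set (Distr d)) ⊆ adjointRange F)
    (hSp : pS ≤ p) (hpG' : p ≤ pG) (hsR : sR ≤ smoothnessBound d sS pS sG pG ε p)
    {uDag : besovSpace W sD pD hD} (hu : (uDag : Distr d) ∈ besovSpace W sS pS hpS) :
    ConvergenceRate F uDag sR ((p + pG) / pG) (rateExponent d sR ((p + pG) / pG)) := by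
  obtain ⟨g, hg, hgc⟩ := exists_mem_besovSpace_coeff_eq_penaltyGradient hpS hpG hε hSp hsR hu
  refine convergenceRate_of_penaltyGradient_mem_adjointRange ?_ ?_ (hFG hg) hgc
  · exact (one_lt_div hpG).2 (lt_add_of_pos_left pG (hpS.trans_le hSp))
  · exact (div_le_iff₀ hpG).2 (by linarith)

theorem convergenceRate_opt {F : besovSpace W sD pD hD →ₗ[ℝ] L2 d} {hpS : 0 < pS}
    {hpG : 0 < pG} (hε : 0 ≤ ε)
    (hFG : (besovSpace W sG pG hpG : Set (Distr d)) ⊆ adjointRange F)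
    (hSD : pS ≤ pD) (hSG : pS ≤ pG)
    {uDag : besovSpace W sD pD hD} (hu : (uDag : Distr d) ∈ besovSpace W sS pS hpS) :
    ConvergenceRate F uDag (optS d sS pS pD sG pG ε) (optP pD pG)
      (optRate d pD sG pG ε sS pS) :=
  convergenceRate_of_mem_besovSpace hε hFG (le_min hSD hSG) (min_le_right pD pG) le_rfl hu

end Rate

end BesovTikhonov

end

open BesovTikhonov in
theorem mainTheorem5_general (d : ℕ) (W : WaveletBasis d) (sD pD sS pS sG pG : ℝ)
    (hpD : 0 < pD) (hpS : 0 < pS) (hpG : 0 < pG) (hSD : pS ≤ pD) (hSG : pS ≤ pG)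
    (hpos : 0 < rateExponent d sS pS + rateExponent d sG pG)
    (F : besovSpace W sD pD hpD →ₗ[ℝ] L2 d)
    (hFG : (besovSpace W sG pG hpG : Set (Distr d)) ⊆ adjointRange F) :
    (∃ ε₀ : ℝ, 0 < ε₀ ∧ ∀ ε : ℝ, 0 < ε → ε < ε₀ →
      AllowedPenalty d sS pS pD sG pG ε (optS d sS pS pD sG pG ε) (optP pD pG) ∧
      ∀ sR pR : ℝ, AllowedPenalty d sS pS pD sG pG ε sR pR →
        rateExponent d sR pR ≤ optRate d pD sG pG ε sS pS ∧
        (rateExponent d sR pR = optRate d pD sG pG ε sS pS →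
          sR = optS d sS pS pD sG pG ε ∧ pR = optP pD pG) ∧
        ∀ u : Distr d, besovNorm W (rateExponent d sR pR) 2 u ≤
          besovNorm W (optRate d pD sG pG ε sS pS) 2 u) ∧
    (pD ≤ pG → ∀ ε : ℝ, 0 ≤ ε → ∀ pR sR σ : ℝ,
      pR = (pD + pG) / pG →
      sR = (pD * sS - pG * sG) / (pD + pG) - d * (1 / (pD + pG) * (pD / pS - 1))
        - ε * (pD / pS - 1) →
      σ = (pD * sS - pG * sG) / (pD + pG)
        + d * (1 / 2 - 1 / (pD + pG) * (pG / pG.conjExponent + pD / pS))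
        - ε * (pD / pS - 1) →
      pR = optP pD pG ∧ sR = optS d sS pS pD sG pG ε ∧ σ = optRate d pD sG pG ε sS pS ∧
      ∀ uDag : besovSpace W sD pD hpD, (uDag : Distr d) ∈ besovSpace W sS pS hpS →
        ConvergenceRate F uDag sR pR σ) ∧
    (pG < pD → ∀ ε : ℝ, 0 ≤ ε → ∀ pR sR : ℝ, pR = 2 →
      sR = 1 / 2 * (sS - d / pS - (sG - d / pG)) - ε * (pG / pS - 1) →
      pR = optP pD pG ∧ sR = optS d sS pS pD sG pG ε ∧ sR = optRate d pD sG pG ε sS pS ∧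
      ∀ uDag : besovSpace W sD pD hpD, (uDag : Distr d) ∈ besovSpace W sS pS hpS →
        ConvergenceRate F uDag sR pR sR) ∧
    (∀ sT pT : ℝ, 0 < pT → sS - d / pS < sT - d / pT →
      (pD ≤ pG →
        optRate d pD sG pG 0 sT pT - optRate d pD sG pG 0 sS pS =
          pD / (pD + pG) * (sT - d / pT - (sS - d / pS))) ∧
      (pG < pD →
        optRate d pD sG pG 0 sT pT - optRate d pD sG pG 0 sS pS =
          1 / 2 * (sT - d / pT - (sS - d / pS))) ∧
      optRate d pD sG pG 0 sS pS < optRate d pD sG pG 0 sT pT ∧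
      ∃ ε₁ : ℝ, 0 < ε₁ ∧ ∀ ε : ℝ, 0 < ε → ε < ε₁ →
        optRate d pD sG pG ε sS pS < optRate d pD sG pG ε sT pT) := by
  refine ⟨⟨pS * (rateExponent d sS pS + rateExponent d sG pG) / (4 * pG), by positivity,
    fun ε _ hε => ⟨allowedPenalty_opt hpD hpG hSD hSG, fun sR pR h => ?_⟩⟩,
    fun hDG ε hε pR sR σ hpR hsR hσ => ?_, fun hGD ε hε pR sR hpR hsR => ?_,
    fun sT pT _ hST => ⟨fun hDG => ?_, fun hGD => ?_, ?_, ?_⟩⟩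
  · have hopt := h.eq_opt_or_rateExponent_lt hpS hpG hpos hε
    have hle := h.rateExponent_le_optRate hpS hpG hpos hε
    exact ⟨hle, fun heq => hopt.resolve_right heq.not_lt, besovNorm_two_mono W hle⟩
  · obtain rfl := hpR.trans (optP_of_le hDG).symm
    obtain rfl := hsR.trans (optS_of_le hDG).symm
    obtain rfl := hσ.trans (optRate_of_le hpD hpG hDG).symm
    exact ⟨rfl, rfl, rfl, fun uDag hu => convergenceRate_opt hε hFG hSD hSG hu⟩
  · obtain rfl := hpR.trans (optP_of_ge hpG hGD.le).symm
    obtain rfl := hsR.trans (optS_of_ge hpG hGD.le).symm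
    rw [optRate_of_ge hpG hGD.le]
    refine ⟨rfl, rfl, rfl, fun uDag hu => ?_⟩
    simpa only [optRate_of_ge hpG hGD.le] using convergenceRate_opt hε hFG hSD hSG hu
  · rw [optRate_zero_sub hpD hpG, min_eq_left hDG]
  · rw [optRate_zero_sub hpD hpG, min_eq_right hGD.le, ← two_mul, div_mul_cancel_right₀ hpG.ne',
      one_div]
  · exact optRate_zero_lt hpD hpG hST
  · exact exists_forall_optRate_lt hpD hpG (optRate_zero_lt hpD hpG hST)

theorem mainTheorem5 (d : ℕ) (hd : 1 ≤ d) (W : BesovTikhonov.WaveletBasis d)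
    (sD pD sS pS sG pG : ℝ) (hpD : 1 < pD) (hpS : 0 < pS) (hpG : 0 < pG)
    -- the embedding of `B_S` into `B_D`
    (hSD : pS ≤ pD) (hSD' : sD - d / pD < sS - d / pS)
    -- the embedding of `B_G` into the dual of `B_D`
    (hGD : 1 / pD.conjExponent ≤ 1 / pG)
    (hGD' : -sD - d / pD.conjExponent ≤ sG - d / pG)
    (hSG : pS ≤ pG)
    (F : BesovTikhonov.besovSpace W sD pD (zero_lt_one.trans hpD) →ₗ[ℝ] BesovTikhonov.L2 d)
    (hF : BesovTikhonov.IsBounded F)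
    (hFG : (BesovTikhonov.besovSpace W sG pG hpG : Set (BesovTikhonov.Distr d)) ⊆
      BesovTikhonov.adjointRange F) :
    -- `p = min {p_D, p_G}` maximizes `σ` among the allowed penalties
    (∃ ε₀ : ℝ, 0 < ε₀ ∧ ∀ ε : ℝ, 0 < ε → ε < ε₀ →
      BesovTikhonov.AllowedPenalty d sS pS pD sG pG ε
        (BesovTikhonov.optS d sS pS pD sG pG ε) (BesovTikhonov.optP pD pG) ∧
      ∀ sR pR : ℝ, BesovTikhonov.AllowedPenalty d sS pS pD sG pG ε sR pR →
        BesovTikhonov.rateExponent d sR pR ≤ BesovTikhonov.optRate d pD sG pG ε sS pS ∧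
        (BesovTikhonov.rateExponent d sR pR = BesovTikhonov.optRate d pD sG pG ε sS pS →
          sR = BesovTikhonov.optS d sS pS pD sG pG ε ∧ pR = BesovTikhonov.optP pD pG) ∧
        ∀ u : BesovTikhonov.Distr d,
          BesovTikhonov.besovNorm W (BesovTikhonov.rateExponent d sR pR) 2 u ≤
            BesovTikhonov.besovNorm W (BesovTikhonov.optRate d pD sG pG ε sS pS) 2 u) ∧
    -- the case `p_G ≥ p_D`
    (pD ≤ pG → ∀ ε : ℝ, 0 < ε → ∀ pR sR σ : ℝ,
      pR = (pD + pG) / pG →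
      sR = (pD * sS - pG * sG) / (pD + pG) - d * (1 / (pD + pG) * (pD / pS - 1))
        - ε * (pD / pS - 1) →
      σ = (pD * sS - pG * sG) / (pD + pG)
        + d * (1 / 2 - 1 / (pD + pG) * (pG / pG.conjExponent + pD / pS))
        - ε * (pD / pS - 1) →
      pR = BesovTikhonov.optP pD pG ∧ sR = BesovTikhonov.optS d sS pS pD sG pG ε ∧
      σ = BesovTikhonov.optRate d pD sG pG ε sS pS ∧
      ∀ uDag : BesovTikhonov.besovSpace W sD pD (zero_lt_one.trans hpD),
        (uDag : BesovTikhonov.Distr d) ∈ BesovTikhonov.besovSpace W sS pS hpS →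
        BesovTikhonov.ConvergenceRate F uDag sR pR σ) ∧
    -- the case `p_G < p_D`
    (pG < pD → ∀ ε : ℝ, 0 < ε → ∀ pR sR : ℝ,
      pR = 2 →
      sR = 1 / 2 * (sS - d / pS - (sG - d / pG)) - ε * (pG / pS - 1) →
      pR = BesovTikhonov.optP pD pG ∧ sR = BesovTikhonov.optS d sS pS pD sG pG ε ∧
      sR = BesovTikhonov.optRate d pD sG pG ε sS pS ∧
      ∀ uDag : BesovTikhonov.besovSpace W sD pD (zero_lt_one.trans hpD),
        (uDag : BesovTikhonov.Distr d) ∈ BesovTikhonov.besovSpace W sS pS hpS →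
        BesovTikhonov.ConvergenceRate F uDag sR pR sR) ∧
    -- tighter source conditions `B_T ⊂ B_S` give larger `σ`
    (∀ sT pT : ℝ, 0 < pT → pT ≤ pS → sS - d / pS < sT - d / pT →
      (pD ≤ pG →
        BesovTikhonov.optRate d pD sG pG 0 sT pT - BesovTikhonov.optRate d pD sG pG 0 sS pS =
          pD / (pD + pG) * (sT - d / pT - (sS - d / pS))) ∧
      (pG < pD →
        BesovTikhonov.optRate d pD sG pG 0 sT pT - BesovTikhonov.optRate d pD sG pG 0 sS pS =
          1 / 2 * (sT - d / pT - (sS - d / pS))) ∧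
      BesovTikhonov.optRate d pD sG pG 0 sS pS < BesovTikhonov.optRate d pD sG pG 0 sT pT ∧
      ∃ ε₁ : ℝ, 0 < ε₁ ∧ ∀ ε : ℝ, 0 < ε → ε < ε₁ →
        BesovTikhonov.optRate d pD sG pG ε sS pS < BesovTikhonov.optRate d pD sG pG ε sT pT) := by
  obtain ⟨hmax, hle, hlt, htighter⟩ := mainTheorem5_general d W sD pD sS pS sG pG
    (zero_lt_one.trans hpD) hpS hpG hSD hSG
    (BesovTikhonov.rateExponent_add_rateExponent_pos hpD hSD' hGD') F hFG
  exact ⟨hmax, fun h ε hε => hle h ε hε.le, fun h ε hε => hlt h ε hε.le,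
    fun sT pT hpT _ => htighter sT pT hpT⟩
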